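/- **Theorem 2.1 (maximal velocity bound for lattice quantum many-body systems).** Let $\Lambda\subset\mathbb R^d$ be a (finite or infinite) subset of a lattice of grid size $\ge 1$; only $|x-y|\ge1$ for distinct $x,y\in\Lambda$ is used. Let $(h_{xy})_{x,y\in\Lambda}$ be a hermitian matrix, $h_{xy}=\overline{h_{yx}}$, and $(v_{xy})_{x,y\in\Lambda}$ an arbitrary real symmetric matrix. On the bosonic Fock space $\mathcal F$ over $\ell^2(\Lambda)$, with annihilation and creation operators $a_x,a_x^*$, let $$H=\sum_{x,y\in\Lambda}h_{xy}\,a_x^*a_y+\frac12\sum_{x,y\in\Lambda}a_x^*a_y^*\,v_{xy}\,a_ya_x ,$$ with domain all $\psi\in\mathcal F$ for which $H\psi$, computed in the occupation number basis, lies in $\mathcal F$. Put $N_S=\sum_{x\in S}a_x^*a_x$ for $S\subset\Lambda$ and $N=N_\Lambda$. For $X\subset\Lambda$ and $\eta\ge 0$ let $X^{\mathrm c}=\Lambda\setminus X$, $X_\eta=\{x\in\Lambda:\ \inf_{y\in X}|x-y|\le\eta\}$ (empty if $X=\emptyset$), and $X_\eta^{\mathrm c}=\Lambda\setminus X_\eta$.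 For $p\ge0$ let $$\kappa_p=\sup_{x\in\Lambda}\sum_{y\in\Lambda}|h_{xy}|\,|x-y|^{p+1},\qquad \kappa=\kappa_0 .$$ Assume that $\kappa_n<\infty$ for some integer $n\ge1$ (hence $\kappa<\infty$). Then the propagator $e^{-itH}$, $t\in\mathbb R$, exists, i.e. there is a strongly continuous one-parameter unitary group with generator exactly $-iH$; and for every $c>\kappa$ there is a constant $C>0$, depending only on $n$, $\kappa_n$, $\kappa$ and $c$, such that for all $\eta\ge1$, all $X\subset\Lambda$ and all real $t$ with $|t|<\eta/c$, $$\alpha_t\big(N_{X_\eta^{\mathrm c}}\big)\ \le\ C\,\big(N_{X^{\mathrm c}}+\eta^{-n}N\big),\qquad \alpha_t(A)=e^{itH}Ae^{-itH}.$$ Here the operator inequality means that, for every positive trace-class operator $\rho$ on $\mathcal F$ and $\rho_t=e^{-itH}\rho\, e^{itH}$, $$\operatorname{Tr}\big(N_{X_\eta^{\mathrm c}}\,\rho_t\big)\ \le\ C\,\Big(\operatorname{Tr}\big(N_{X^{\mathrm c}}\,\rho\big)+\eta^{-n}\operatorname{Tr}\big(N\rho\big)\Big)\qquad\text{in }[0,\infty];$$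 in particular it holds, with both sides finite, for all states $\rho$ with $\operatorname{Tr}(N^2\rho)<\infty$ that lie in the domain of $\rho\mapsto[H,\rho]$. -/

import Mathlib

open scoped ENNReal NNReal

noncomputable section

namespace LatticeBosons

variable {d : ℕ} {Λ : Set (EuclideanSpace ℝ (Fin d))}

/-- The moments `κ_p = sup_x ∑_y |h_xy| |x - y|^(p+1)` of a hopping matrix, as elements of `[0, ∞]`.
The velocity bound `κ` is `κ_0`. -/
def hopMoment (h : Λ → Λ → ℂ) (p : ℕ) : ℝ≥0∞ :=
  ⨆ x : Λ, ∑' y : Λ, ENNReal.ofReal (‖h x y‖ * dist x y ^ (p + 1))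

/-- Occupation numbers of the sites: finitely supported functions `Λ → ℕ`. -/
abbrev Config (Λ : Set (EuclideanSpace ℝ (Fin d))) : Type := Λ →₀ ℕ

/-- The bosonic Fock space over `ℓ²(Λ)` in the occupation number representation: the value
`ψ σ` is the coefficient of `ψ` along the normalized symmetric vector
`∏ x, (a*_x)^(σ x) / √((σ x)!) Ω`, and these vectors form an orthonormal basis of Fock space. -/
abbrev Fock (Λ : Set (EuclideanSpace ℝ (Fin d))) : Type := lp (fun _ : Config Λ => ℂ) 2

/-- The occupation number basis vector of the configuration `σ`. -/
def basisVec (σ : Config Λ) : Fock Λ :=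
  haveI := Classical.decEq (Config Λ)
  lp.single 2 σ (1 : ℂ)

/-- The annihilation operator `a_x`, acting on coefficient functions:
`a_x |σ⟩ = √(σ x) |σ - δ_x⟩`. -/
def annihilate (x : Λ) (ψ : Config Λ → ℂ) : Config Λ → ℂ := fun σ =>
  (Real.sqrt ((σ x : ℝ) + 1) : ℂ) * ψ (σ + Finsupp.single x 1)

/-- The creation operator `a*_x`, acting on coefficient functions:
`a*_x |σ⟩ = √(σ x + 1) |σ + δ_x⟩` (the coefficient vanishes at configurations with `σ x = 0`). -/
def create (x : Λ) (ψ : Config Λ → ℂ) : Config Λ → ℂ := fun σ =>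
  (Real.sqrt (σ x : ℝ) : ℂ) * ψ (σ - Finsupp.single x 1)

/-- The Hamiltonian `∑ h_xy a*_x a_y + ½ ∑ a*_x a*_y v_xy a_y a_x`, acting on coefficient
functions. As an operator on Fock space it has the domain of those `ψ` for which the
result is again square summable. -/
def hamiltonian (h : Λ → Λ → ℂ) (v : Λ → Λ → ℝ) (ψ : Config Λ → ℂ) : Config Λ → ℂ := fun σ =>
  (∑' p : Λ × Λ, h p.1 p.2 * create p.1 (annihilate p.2 ψ) σ) +
    (1 / 2 : ℂ) * ∑' p : Λ × Λ,
      (v p.1 p.2 : ℂ) * create p.1 (create p.2 (annihilate p.2 (annihilate p.1 ψ))) σ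

/-- The local particle number operator `N_S = ∑_{x ∈ S} a*_x a_x`, on coefficient functions. -/
def number (S : Set Λ) (ψ : Config Λ → ℂ) : Config Λ → ℂ := fun σ =>
  ∑' x : S, create (x : Λ) (annihilate (x : Λ) ψ) σ

/-- `U` is the propagator `t ↦ e^{-itH}` of the Hamiltonian `H`: the strongly continuous
one-parameter unitary group whose generator is exactly `-iH`. That is, `t ↦ U t ψ` has the
derivative `-iφ` at `0` if and only if `ψ` is in the domain of `H` and `H ψ = φ`. -/
structure IsPropagator (h : Λ → Λ → ℂ) (v : Λ → Λ → ℝ) (U : ℝ → (Fock Λ →L[ℂ] Fock Λ)) :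
    Prop where
  mem_unitary : ∀ t, U t ∈ unitary (Fock Λ →L[ℂ] Fock Λ)
  map_zero : U 0 = 1
  map_add : ∀ s t, U (s + t) = U s * U t
  continuous : ∀ ψ, Continuous fun t => U t ψ
  generator : ∀ ψ φ : Fock Λ,
    hamiltonian h v (ψ : Config Λ → ℂ) = (φ : Config Λ → ℂ) ↔
      HasDerivAt (fun t => U t ψ) (-(Complex.I • φ)) 0

/-- The expectation `Tr (A ρ) = ∑_σ ⟨σ, A ρ σ⟩ ∈ [0, ∞]`, for a positive operator `ρ` and
a nonnegative observable `A` that is diagonal in the occupation number basis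
(such as the identity and all number operators), so that every term is a nonnegative real. -/
def expectation (A : (Config Λ → ℂ) → (Config Λ → ℂ)) (ρ : Fock Λ →L[ℂ] Fock Λ) : ℝ≥0∞ :=
  ∑' σ : Config Λ, ENNReal.ofReal (A (ρ (basisVec σ) : Config Λ → ℂ) σ).re

/-- Density operators: positive operators of finite trace. -/
def IsDensity (ρ : Fock Λ →L[ℂ] Fock Λ) : Prop :=
  ρ.IsPositive ∧ expectation id ρ < ∞

/-- The evolved density operator `ρ_t = e^{-itH} ρ e^{itH}`, dual to the Heisenberg evolution
`α_t (A) = e^{itH} A e^{-itH}`: the expectation of `A` in `ρ_t` is that of `α_t (A)` in `ρ`. -/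
def evolve (U : ℝ → (Fock Λ →L[ℂ] Fock Λ)) (t : ℝ) (ρ : Fock Λ →L[ℂ] Fock Λ) :
    Fock Λ →L[ℂ] Fock Λ :=
  U t * ρ * star (U t)

end LatticeBosons

end

/-! Existence of the propagator. For a hermitian matrix on `ℓ²` with square summable columns, the
maximal operator generates a unitary group as soon as it is symmetric (`exists_unitaryGroup`):
finite truncations generate unitary groups, weak limits of these solve the Schrödinger equation
coefficientwise, and symmetry makes bounded solutions unique. For the Hamiltonian the imaginary part
of `⟨ψ, Hψ⟩` splits over the sectors of fixed particle number. The interaction and the on-site terms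
are real and diagonal, so they drop out however large they are. The hopping sums converge absolutely
within a sector and cancel after exchanging the two sites (`maximalSymmetric_hamiltonianColumn`).

Velocity bound. Take `κ < c' < c` and let `u` be the distance to `X`. Follow the second quantization
of the moving weight `f((u x - r - c' t) / s)`, with `f` the increasing function `profile n` and
`f'` its derivative `slope n`. The motion of the front contributes `-(c' / s)` times the second
quantization of `f'`. The commutator with `H` only sees differences of the weight across a hop
(`current_le`). By `exists_profile_scale` such a difference is at most `m x y` times the geometric
mean of the two values of `f'`, where `m x y` combines `|x - y|` and `|x - y|^(n + 1)`. The
arithmetic-geometric mean inequality and the Schur test then bound the current by `c' / s` times the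
second quantization of the same `f'`. The weighted number is therefore nonincreasing
(`antitone_diagForm_front`).

At the final time the weight is at least `1 / n` where `u ≥ η`; initially it is at most a constant
times `η⁻ⁿ` on `X` and at most `2` elsewhere. This gives the bound for pure states
(`tsum_occupation_le`), and writing `ρ = B B*` gives it for density operators. A cutoff in the
particle number, which the dynamics preserves, keeps every observable bounded until the last
comparison. -/

noncomputable section

namespace LatticeBosons

open Filter Topology Set

/-! ### Unitary groups generated by hermitian matrices on `ℓ²`. -/

section MatrixGenerator

variable {I : Type*}

/-- The square summable complex families on `I`. -/
abbrev EllTwo (I : Type*) : Type _ := lp (fun _ : I => ℂ) 2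

/-- The unit vector of `ℓ²` at an index. -/
def unitVec (i : I) : EllTwo I :=
  haveI := Classical.decEq I
  lp.single 2 i (1 : ℂ)

lemma inner_unitVec_left (i : I) (f : EllTwo I) : inner ℂ (unitVec i) f = f i := by
  classical
  simp only [unitVec]
  rw [lp.inner_single_left]
  simp

lemma inner_unitVec_right (i : I) (f : EllTwo I) :
    inner ℂ f (unitVec i) = starRingEnd ℂ (f i) := by
  rw [← inner_conj_symm, inner_unitVec_left]

lemma norm_unitVec (i : I) : ‖(unitVec i : EllTwo I)‖ = 1 := by
  classical
  simp only [unitVec]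
  rw [lp.norm_single (by norm_num)]
  simp

lemma unitVec_self (i : I) : (unitVec i : EllTwo I) i = 1 := by
  classical
  exact lp.single_apply_self (E := fun _ : I => ℂ) 2 i (1 : ℂ)

lemma unitVec_ne {i j : I} (h : j ≠ i) : (unitVec i : EllTwo I) j = 0 := by
  classical
  exact lp.single_apply_ne (E := fun _ : I => ℂ) 2 i (1 : ℂ) h

lemma hasSum_unitVec (f : EllTwo I) : HasSum (fun i => f i • (unitVec i : EllTwo I)) f := by
  classical
  refine (lp.hasSum_single (p := 2) (by norm_num) f).congr_fun fun i => ?_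
  simp only [unitVec]
  rw [← lp.single_smul, smul_eq_mul, mul_one]

lemma tendsto_sum_unitVec (f : EllTwo I) :
    Tendsto (fun F : Finset I => ∑ i ∈ F, f i • (unitVec i : EllTwo I)) atTop (𝓝 f) := by
  have h := hasSum_unitVec f
  rwa [HasSum, SummationFilter.unconditional_filter] at h

/-- Density of the finitely supported families, as an induction principle. -/
lemma ellTwo_induction {P : EllTwo I → Prop} (hsingle : ∀ i, P (unitVec i))
    (hzero : P 0) (hadd : ∀ f g, P f → P g → P (f + g)) (hsmul : ∀ (c : ℂ) f, P f → P (c • f))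
    (happrox : ∀ f, (∀ ε > (0 : ℝ), ∃ g, P g ∧ ‖f - g‖ < ε) → P f) (f : EllTwo I) : P f := by
  refine happrox f fun ε hε => ?_
  have hsum : ∀ F : Finset I, P (∑ i ∈ F, f i • (unitVec i : EllTwo I)) := fun F =>
    Finset.sum_induction _ P hadd hzero fun i _ => hsmul _ _ (hsingle i)
  have h := (tendsto_sum_unitVec f).eventually (Metric.ball_mem_nhds f hε)
  obtain ⟨F, hF⟩ := h.exists
  refine ⟨_, hsum F, ?_⟩
  rwa [dist_comm, dist_eq_norm] at hF

lemma continuous_inner_of_bounded {y : ℝ → EllTwo I} {C : ℝ} (hb : ∀ t, ‖y t‖ ≤ C)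
    (hc : ∀ i, Continuous fun t => y t i) (f : EllTwo I) :
    Continuous fun t => inner ℂ (y t) f := by
  have hC : 0 ≤ C := (norm_nonneg _).trans (hb 0)
  induction f using ellTwo_induction with
  | hsingle i =>
    simp_rw [inner_unitVec_right]
    exact Complex.continuous_conj.comp (hc i)
  | hzero => simpa using continuous_const
  | hadd f g hf hg => simp_rw [inner_add_right]; exact hf.add hg
  | hsmul c f hf => simpa [inner_smul_right] using hf.const_mul c
  | happrox f h =>
    refine continuous_of_uniform_approx_of_continuous fun u hu => ?_
    obtain ⟨ε, hε, hu⟩ := Metric.mem_uniformity_dist.1 hu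
    obtain ⟨g, hg, hfg⟩ := h (ε / (C + 1)) (by positivity)
    refine ⟨_, hg, fun t => hu ?_⟩
    rw [dist_eq_norm, ← inner_sub_right]
    calc ‖inner ℂ (y t) (f - g)‖ ≤ ‖y t‖ * ‖f - g‖ := norm_inner_le_norm _ _
      _ ≤ (C + 1) * ‖f - g‖ := by gcongr; linarith [hb t]
      _ < (C + 1) * (ε / (C + 1)) := by gcongr
      _ = ε := by field_simp

/-- Bounded solutions of `i y' = H y`, coefficientwise, where `H` has the columns `k`. -/
structure IsWeakSolution (k : I → EllTwo I) (y : ℝ → EllTwo I) : Prop where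
  bounded : ∃ C, ∀ t, ‖y t‖ ≤ C
  deriv : ∀ i t, HasDerivAt (fun t => y t i) (-(Complex.I * inner ℂ (k i) (y t))) t

/-- The maximal operator with the columns `k` is symmetric. -/
def MaximalSymmetric (k : I → EllTwo I) : Prop :=
  ∀ f g : EllTwo I, (∀ i, inner ℂ (k i) f = g i) → (inner ℂ f g).im = 0

lemma IsWeakSolution.continuous_inner {k : I → EllTwo I} {y : ℝ → EllTwo I}
    (hy : IsWeakSolution k y) (f : EllTwo I) : Continuous fun t => inner ℂ (y t) f := by
  obtain ⟨C, hC⟩ := hy.bounded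
  exact continuous_inner_of_bounded hC
    (fun i => continuous_iff_continuousAt.2 fun t => (hy.deriv i t).continuousAt) f

lemma IsWeakSolution.continuous_inner_left {k : I → EllTwo I} {y : ℝ → EllTwo I}
    (hy : IsWeakSolution k y) (f : EllTwo I) : Continuous fun t => inner ℂ f (y t) := by
  have := Complex.continuous_conj.comp (hy.continuous_inner f)
  refine this.congr fun t => ?_
  simp

/-- The primitive `∫₀ᵗ y` of a weakly continuous function, through the Riesz representation. -/
lemma exists_primitive {y : ℝ → EllTwo I} {C : ℝ} (hb : ∀ t, ‖y t‖ ≤ C)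
    (hc : ∀ f, Continuous fun t => inner ℂ (y t) f) :
    ∃ Y : ℝ → EllTwo I, ∀ t f, inner ℂ (Y t) f = ∫ s in (0 : ℝ)..t, inner ℂ (y s) f := by
  have hC : 0 ≤ C := (norm_nonneg _).trans (hb 0)
  have key : ∀ t : ℝ, ∃ z : EllTwo I, ∀ f, inner ℂ z f = ∫ s in (0 : ℝ)..t, inner ℂ (y s) f := by
    intro t
    let L : EllTwo I →ₗ[ℂ] ℂ :=
      { toFun := fun f => ∫ s in (0 : ℝ)..t, inner ℂ (y s) f
        map_add' := fun f g => by
          simp_rw [inner_add_right]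
          exact intervalIntegral.integral_add ((hc f).intervalIntegrable _ _)
            ((hc g).intervalIntegrable _ _)
        map_smul' := fun c f => by
          simp_rw [inner_smul_right]
          simp }
    let L' : EllTwo I →L[ℂ] ℂ := L.mkContinuous (C * |t|) fun f => by
      have := intervalIntegral.norm_integral_le_of_norm_le_const (a := 0) (b := t)
        (C := C * ‖f‖) (f := fun s => inner ℂ (y s) f) fun s _ =>
          (norm_inner_le_norm _ _).trans (by gcongr; exact hb s)
      calc ‖L f‖ ≤ C * ‖f‖ * |t - 0| := this
        _ = C * |t| * ‖f‖ := by rw [sub_zero]; ring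
    refine ⟨(InnerProductSpace.toDual ℂ (EllTwo I)).symm L', fun f => ?_⟩
    rw [InnerProductSpace.toDual_symm_apply]
    rfl
  choose Y hY using key
  exact ⟨Y, hY⟩

/-- The solution `y` itself need not lie in the maximal domain, but its primitive `Y` does:
integrating the equation gives `H Y = i y`. Symmetry then says `Re ⟨y, Y⟩ = 0`, so `‖Y‖²` is
constant, `Y = 0`, and `y = 0`. -/
lemma IsWeakSolution.eq_zero {k : I → EllTwo I} (hk : MaximalSymmetric k) {y : ℝ → EllTwo I}
    (hy : IsWeakSolution k y) (h0 : y 0 = 0) (t : ℝ) : y t = 0 := by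
  obtain ⟨C, hC⟩ := hy.bounded
  have hC0 : 0 ≤ C := (norm_nonneg _).trans (hC 0)
  have hc := hy.continuous_inner
  obtain ⟨Y, hY⟩ := exists_primitive hC hc
  have hHY : ∀ t i, inner ℂ (k i) (Y t) = (Complex.I • y t) i := by
    intro t i
    have h1 : ∫ s in (0 : ℝ)..t, -(Complex.I * inner ℂ (k i) (y s)) = y t i - y 0 i :=
      intervalIntegral.integral_eq_sub_of_hasDerivAt (fun s _ => hy.deriv i s)
        (((continuous_const.mul (hy.continuous_inner_left (k i))).neg).intervalIntegrable _ _)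
    have h2 : inner ℂ (k i) (Y t) = ∫ s in (0 : ℝ)..t, inner ℂ (k i) (y s) := by
      rw [← inner_conj_symm, hY]
      simp_rw [← inner_conj_symm (k i), intervalIntegral.intervalIntegral_eq_integral_uIoc,
        integral_conj]
      split_ifs <;> simp
    rw [intervalIntegral.integral_neg, intervalIntegral.integral_const_mul, ← h2, h0] at h1
    simp only [lp.coeFn_smul, Pi.smul_apply, smul_eq_mul, lp.coeFn_zero, Pi.zero_apply,
      sub_zero] at h1 ⊢
    rw [← h1]
    linear_combination (inner ℂ (k i) (Y t)) * Complex.I_mul_I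
  have hre : ∀ t, (inner ℂ (y t) (Y t)).re = 0 := by
    intro t
    have := hk _ _ (hHY t)
    rw [inner_smul_right] at this
    rw [← inner_conj_symm, Complex.conj_re]
    simpa using this
  have hdiff : ∀ t t' f, inner ℂ (Y t' - Y t) f = ∫ s in t..t', inner ℂ (y s) f := by
    intro t t' f
    rw [inner_sub_left, hY, hY, intervalIntegral.integral_interval_sub_left
      ((hc f).intervalIntegrable _ _) ((hc f).intervalIntegrable _ _)]
  have hlip : ∀ t t', ‖Y t' - Y t‖ ≤ C * |t' - t| := by
    intro t t'
    have h1 : ‖Y t' - Y t‖ * ‖Y t' - Y t‖ ≤ C * ‖Y t' - Y t‖ * |t' - t| := by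
      have := intervalIntegral.norm_integral_le_of_norm_le_const (a := t) (b := t')
        (C := C * ‖Y t' - Y t‖) (f := fun s => inner ℂ (y s) (Y t' - Y t)) fun s _ =>
          (norm_inner_le_norm _ _).trans (by gcongr; exact hC s)
      rw [← hdiff] at this
      rwa [inner_self_eq_norm_sq_to_K, norm_pow, RCLike.norm_ofReal, abs_norm, pow_two] at this
    by_cases hz : ‖Y t' - Y t‖ = 0
    · rw [hz]; positivity
    · have hpos : 0 < ‖Y t' - Y t‖ := lt_of_le_of_ne (norm_nonneg _) (Ne.symm hz)
      nlinarith
  -- Since `y` is only weakly continuous, `‖Y s‖²` is expanded as `2 Re ⟨Y s, Y t⟩ - ‖Y t‖² + ‖Y s -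
  -- Y t‖²`: the first term is differentiable weakly and the last is `O((s - t)²)` by the Lipschitz
  -- bound.
  have hder : ∀ t, HasDerivAt (fun t => ‖Y t‖ ^ 2) 0 t := by
    intro t
    have h1 : HasDerivAt (fun t' => (inner ℂ (Y t') (Y t)).re) 0 t := by
      have := intervalIntegral.integral_hasDerivAt_right ((hc (Y t)).intervalIntegrable 0 t)
        ((hc (Y t)).stronglyMeasurableAtFilter _ _) (hc (Y t)).continuousAt
      have := Complex.reCLM.hasFDerivAt.comp_hasDerivAt t this
      simp only [Complex.reCLM_apply, hre] at this
      refine this.congr_of_eventuallyEq (Eventually.of_forall fun s => ?_)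
      simp [hY]
    have h2 : HasDerivAt (fun t' => ‖Y t' - Y t‖ ^ 2) 0 t := by
      rw [hasDerivAt_iff_isLittleO]
      have : (fun t' => ‖Y t' - Y t‖ ^ 2) =O[𝓝 t] fun t' => (t' - t) ^ 2 := by
        refine Asymptotics.IsBigO.of_bound (C ^ 2) (Eventually.of_forall fun t' => ?_)
        rw [Real.norm_of_nonneg (by positivity), Real.norm_of_nonneg (by positivity), ← sq_abs (t' - t),
          ← mul_pow]
        exact pow_le_pow_left₀ (norm_nonneg _) (hlip t t') 2
      have h3 : (fun t' => (t' - t) ^ 2) =o[𝓝 t] fun t' => t' - t :=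
        by simpa using (Asymptotics.isLittleO_pow_sub_sub t (m := 2) (by norm_num))
      simpa using this.trans_isLittleO h3
    have h4 := (((h1.const_mul 2).add h2).sub_const (‖Y t‖ ^ 2))
    simp only [mul_zero, add_zero] at h4
    refine h4.congr_of_eventuallyEq (Eventually.of_forall fun s => ?_)
    have := norm_sub_sq (𝕜 := ℂ) (Y s) (Y t)
    simp only [RCLike.re_to_complex] at this
    simp only [Pi.add_apply]
    linarith
  have hY0 : Y 0 = 0 := by
    rw [← inner_self_eq_zero (𝕜 := ℂ), hY]; simp
  have hYz : ∀ t, Y t = 0 := by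
    intro t
    have := is_const_of_deriv_eq_zero (fun t => (hder t).differentiableAt)
      (fun t => (hder t).deriv) t 0
    simpa [hY0] using this
  ext i
  have := hHY t i
  rw [hYz t] at this
  simpa using this.symm


/-- The truncation of the matrix with columns `k` to a finite set of indices. -/
def truncation (k : I → EllTwo I) (F : Finset I) : EllTwo I →L[ℂ] EllTwo I :=
  ∑ i ∈ F, ∑ j ∈ F, (k j i) • InnerProductSpace.rankOne ℂ (unitVec i) (unitVec j)

lemma isSelfAdjoint_truncation {k : I → EllTwo I}
    (hk : ∀ i j, k i j = starRingEnd ℂ (k j i)) (F : Finset I) :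
    IsSelfAdjoint (truncation k F) := by
  rw [isSelfAdjoint_iff, truncation, star_sum]
  simp_rw [star_sum, star_smul, ContinuousLinearMap.star_eq_adjoint,
    InnerProductSpace.adjoint_rankOne]
  rw [Finset.sum_comm]
  refine Finset.sum_congr rfl fun i _ => Finset.sum_congr rfl fun j _ => ?_
  rw [hk j i]
  rfl

lemma truncation_unitVec (k : I → EllTwo I) {F : Finset I} {j : I} (hj : j ∈ F) :
    truncation k F (unitVec j) = ∑ i ∈ F, k j i • (unitVec i : EllTwo I) := by
  simp only [truncation, sum_apply, smul_apply,
    InnerProductSpace.rankOne_apply, inner_unitVec_left]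
  refine Finset.sum_congr rfl fun i _ => ?_
  rw [Finset.sum_eq_single_of_mem j hj]
  · rw [unitVec_self, one_smul]
  · intro l _ hl
    rw [unitVec_ne hl, zero_smul, smul_zero]

lemma tendsto_truncation_unitVec (k : I → EllTwo I) (j : I) :
    Tendsto (fun F => truncation k F (unitVec j)) atTop (𝓝 (k j)) := by
  refine (tendsto_sum_unitVec (k j)).congr' ?_
  filter_upwards [eventually_ge_atTop {j}] with F hF
  rw [truncation_unitVec k (hF (Finset.mem_singleton_self j))]

/-! ### The unitary group of a bounded self-adjoint operator. -/

section BoundedGenerator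

variable {E : Type*} [NormedAddCommGroup E] [InnerProductSpace ℂ E] [CompleteSpace E]

/-- The group `e^{-itA}` of a bounded operator. -/
def boundedGroup (A : E →L[ℂ] E) (t : ℝ) : E →L[ℂ] E := NormedSpace.exp (t • (-(Complex.I • A)))

lemma boundedGroup_zero (A : E →L[ℂ] E) : boundedGroup A 0 = 1 := by
  simp [boundedGroup]

lemma boundedGroup_add (A : E →L[ℂ] E) (s t : ℝ) :
    boundedGroup A (s + t) = boundedGroup A s * boundedGroup A t := by
  let _ : NormedAlgebra ℚ (E →L[ℂ] E) := NormedAlgebra.restrictScalars ℚ ℂ _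
  rw [boundedGroup, add_smul, NormedSpace.exp_add_of_commute]
  · rfl
  · exact ((Commute.refl _).smul_left s).smul_right t

lemma boundedGroup_mem_unitary {A : E →L[ℂ] E} (hA : IsSelfAdjoint A) (t : ℝ) :
    boundedGroup A t ∈ unitary (E →L[ℂ] E) := by
  have h := (selfAdjoint.expUnitary ⟨(-t) • A, (IsSelfAdjoint.all (-t)).smul hA⟩).2
  rw [selfAdjoint.expUnitary_coe] at h
  have h2 : t • (-(Complex.I • A)) = Complex.I • ((-t) • A) := by
    rw [smul_neg, neg_smul, smul_neg, smul_comm t Complex.I]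
  rw [boundedGroup, h2]
  exact h

lemma norm_boundedGroup_apply {A : E →L[ℂ] E} (hA : IsSelfAdjoint A) (t : ℝ) (x : E) :
    ‖boundedGroup A t x‖ = ‖x‖ :=
  (ContinuousLinearMap.norm_map_iff_adjoint_comp_self _).2
    (Unitary.mem_iff.1 (boundedGroup_mem_unitary hA t)).1 x

lemma inner_boundedGroup_left {A : E →L[ℂ] E} (hA : IsSelfAdjoint A) (t : ℝ) (x y : E) :
    inner ℂ (boundedGroup A t x) y = inner ℂ x (boundedGroup A (-t) y) := by
  have h1 : boundedGroup A t (boundedGroup A (-t) y) = y := by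
    rw [← mul_apply_eq_comp, ← boundedGroup_add, add_neg_cancel, boundedGroup_zero]
    rfl
  conv_lhs => rw [← h1]
  exact (ContinuousLinearMap.inner_map_map_iff_adjoint_comp_self _).2
    (Unitary.mem_iff.1 (boundedGroup_mem_unitary hA t)).1 _ _

lemma hasDerivAt_boundedGroup (A : E →L[ℂ] E) (x : E) (t : ℝ) :
    HasDerivAt (fun t => boundedGroup A t x) (-(Complex.I • boundedGroup A t (A x))) t := by
  have h := (hasDerivAt_exp_smul_const (𝕂 := ℝ) (-(Complex.I • A)) t)
  have h2 := ((ContinuousLinearMap.apply ℂ E x).restrictScalars ℝ).hasFDerivAt.comp_hasDerivAt t h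
  have h3 : ((ContinuousLinearMap.apply ℂ E x).restrictScalars ℝ)
      (NormedSpace.exp (t • -(Complex.I • A)) * -(Complex.I • A)) =
      -(Complex.I • boundedGroup A t (A x)) := by
    change boundedGroup A t ((-(Complex.I • A)) x) = _
    simp
  rw [h3] at h2
  exact h2

lemma norm_boundedGroup_sub_le {A : E →L[ℂ] E} (hA : IsSelfAdjoint A) (x : E) (t : ℝ) :
    ‖boundedGroup A t x - x‖ ≤ ‖A x‖ * |t| := by
  have h := Convex.norm_image_sub_le_of_norm_hasDerivWithin_le (s := univ) (x := 0) (y := t)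
    (C := ‖A x‖)
    (fun s _ => (hasDerivAt_boundedGroup A x s).hasDerivWithinAt)
    (fun s _ => by rw [norm_neg, norm_smul, Complex.norm_I, one_mul, norm_boundedGroup_apply hA])
    convex_univ (mem_univ _) (mem_univ _)
  simpa [boundedGroup_zero] using h

end BoundedGenerator

/-- The truncated evolutions are uniformly strongly continuous at time zero. -/
lemma eventually_norm_boundedGroup_sub_le {k : I → EllTwo I}
    (hk : ∀ i j, k i j = starRingEnd ℂ (k j i)) (f : EllTwo I) :
    ∀ ε > 0, ∃ δ > 0, ∀ᶠ F in atTop, ∀ t, |t| ≤ δ →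
      ‖boundedGroup (truncation k F) t f - f‖ ≤ ε := by
  induction f using ellTwo_induction with
  | hsingle i =>
    intro ε hε
    refine ⟨ε / (‖k i‖ + 1), by positivity, ?_⟩
    filter_upwards [(tendsto_truncation_unitVec k i).norm.eventually
      (eventually_le_nhds (lt_add_one ‖k i‖))] with F hF t ht
    calc _ ≤ _ := norm_boundedGroup_sub_le (isSelfAdjoint_truncation hk F) _ t
      _ ≤ (‖k i‖ + 1) * (ε / (‖k i‖ + 1)) := by gcongr
      _ = ε := by field_simp
  | hzero => exact fun ε hε => ⟨1, one_pos, by simp [hε.le]⟩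
  | hadd f g hf hg =>
    intro ε hε
    obtain ⟨δ, hδ, h1⟩ := hf (ε / 2) (by positivity)
    obtain ⟨δ', hδ', h2⟩ := hg (ε / 2) (by positivity)
    refine ⟨min δ δ', lt_min hδ hδ', ?_⟩
    filter_upwards [h1, h2] with F h1 h2 t ht
    rw [_root_.map_add, add_sub_add_comm]
    exact (norm_add_le _ _).trans (by
      linarith [h1 t (ht.trans (min_le_left _ _)), h2 t (ht.trans (min_le_right _ _))])
  | hsmul c f hf =>
    intro ε hε
    obtain ⟨δ, hδ, h1⟩ := hf (ε / (‖c‖ + 1)) (by positivity)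
    refine ⟨δ, hδ, ?_⟩
    filter_upwards [h1] with F h1 t ht
    rw [map_smul, ← smul_sub, norm_smul]
    calc _ ≤ (‖c‖ + 1) * (ε / (‖c‖ + 1)) := by gcongr; linarith; exact h1 t ht
      _ = ε := by field_simp
  | happrox f hf =>
    intro ε hε
    obtain ⟨g, hg, hfg⟩ := hf (ε / 3) (by positivity)
    obtain ⟨δ, hδ, h1⟩ := hg (ε / 3) (by positivity)
    refine ⟨δ, hδ, ?_⟩
    filter_upwards [h1] with F h1 t ht
    have h2 : boundedGroup (truncation k F) t f - f =
        boundedGroup (truncation k F) t (f - g) + (boundedGroup (truncation k F) t g - g)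
          - (f - g) := by
      rw [map_sub]; abel
    have h3 := norm_boundedGroup_apply (isSelfAdjoint_truncation hk F) t (f - g)
    rw [h2]
    refine (norm_sub_le _ _).trans ?_
    have h4 := norm_add_le (boundedGroup (truncation k F) t (f - g))
      (boundedGroup (truncation k F) t g - g)
    linarith [h1 t ht]

/-- A bounded family of operators has a weak limit along every ultrafilter. -/
lemma exists_weak_limit {ι E : Type*} [NormedAddCommGroup E] [InnerProductSpace ℂ E]
    [CompleteSpace E] (𝒰 : Ultrafilter ι) (V : ι → E →L[ℂ] E) (hV : ∀ i x, ‖V i x‖ ≤ ‖x‖) :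
    ∃ W : E →L[ℂ] E, (∀ x, ‖W x‖ ≤ ‖x‖) ∧
      ∀ x y, Tendsto (fun i => inner ℂ x (V i y)) 𝒰 (𝓝 (inner ℂ x (W y))) := by
  have hlim : ∀ x y : E, ∃ z : ℂ, ‖z‖ ≤ ‖x‖ * ‖y‖ ∧
      Tendsto (fun i => inner ℂ (V i x) y) 𝒰 (𝓝 z) := by
    intro x y
    obtain ⟨z, hz, hz'⟩ := (isCompact_closedBall (0 : ℂ) (‖x‖ * ‖y‖)).ultrafilter_le_nhds'
      (𝒰.map fun i => inner ℂ (V i x) y) (by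
        refine Ultrafilter.mem_map.2 (Filter.univ_mem' fun i => ?_)
        simp only [mem_preimage, mem_closedBall_zero_iff]
        exact (norm_inner_le_norm _ _).trans (by gcongr; exact hV i x))
    exact ⟨z, by simpa using hz, hz'⟩
  choose B hB hB' using hlim
  -- The pointwise limits form a sesquilinear form of norm at most one; the operator representing it
  -- is the weak limit.
  let B₂ : E →ₗ⋆[ℂ] E →ₗ[ℂ] ℂ := LinearMap.mk₂'ₛₗ (starRingEnd ℂ) (RingHom.id ℂ) B
    (fun x x' y => tendsto_nhds_unique (hB' _ _) (by
      simpa [inner_add_left] using (hB' x y).add (hB' x' y)))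
    (fun c x y => tendsto_nhds_unique (hB' _ _) (by
      simpa [inner_smul_left, mul_comm] using (hB' x y).const_mul (starRingEnd ℂ c)))
    (fun x y y' => tendsto_nhds_unique (hB' _ _) (by
      simpa [inner_add_right] using (hB' x y).add (hB' x y')))
    (fun c x y => tendsto_nhds_unique (hB' _ _) (by
      simpa [inner_smul_right] using (hB' x y).const_mul c))
  let W := InnerProductSpace.continuousLinearMapOfBilin
    (B₂.mkContinuous₂ 1 fun x y => by rw [one_mul]; exact hB x y)
  have hW : ∀ x y, inner ℂ (W x) y = B x y := fun x y =>
    InnerProductSpace.continuousLinearMapOfBilin_apply _ _ _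
  refine ⟨W, fun x => ?_, fun x y => ?_⟩
  · have h := hB x (W x)
    rw [← hW, inner_self_eq_norm_sq_to_K, norm_pow, RCLike.norm_ofReal, abs_norm, pow_two] at h
    by_cases hz : ‖W x‖ = 0
    · rw [hz]; positivity
    · exact le_of_mul_le_mul_right h (lt_of_le_of_ne (norm_nonneg _) (Ne.symm hz))
  · have h := (Complex.continuous_conj.tendsto _).comp (hB' y x)
    rw [← hW, inner_conj_symm] at h
    refine h.congr fun i => ?_
    simp [inner_conj_symm]

/-- The truncated groups are contractions, so a weak limit along an ultrafilter exists at every time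
simultaneously. The differential equation survives the limit because the error in its difference
quotients is bounded uniformly in the truncation. -/
lemma exists_weakSolutions {k : I → EllTwo I} (hk : ∀ i j, k i j = starRingEnd ℂ (k j i)) :
    ∃ W : ℝ → EllTwo I →L[ℂ] EllTwo I, W 0 = 1 ∧ (∀ t f, ‖W t f‖ ≤ ‖f‖) ∧
      ∀ f, IsWeakSolution k fun t => W t f := by
  let 𝒰 : Ultrafilter (Finset I) := Ultrafilter.of atTop
  have h𝒰 : (𝒰 : Filter (Finset I)) ≤ atTop := Ultrafilter.of_le _
  let V : ℝ → Finset I → EllTwo I →L[ℂ] EllTwo I := fun t F => boundedGroup (truncation k F) t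
  have hsa := isSelfAdjoint_truncation hk
  have hV : ∀ t F f, ‖V t F f‖ = ‖f‖ := fun t F f => norm_boundedGroup_apply (hsa F) t f
  choose W hW1 hW2 using fun t => exists_weak_limit 𝒰 (V t) fun F f => (hV t F f).le
  refine ⟨W, ?_, hW1, fun f => ⟨⟨‖f‖, fun t => hW1 t f⟩, fun i t => ?_⟩⟩
  · ext f i
    have h := hW2 0 (unitVec i) f
    simp only [V, boundedGroup_zero, inner_unitVec_left] at h
    exact (tendsto_nhds_unique h tendsto_const_nhds)
  rw [hasDerivAt_iff_isLittleO, Asymptotics.isLittleO_iff]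
  intro c hc
  set ε := c / (2 * (‖f‖ + 1)) with hε
  have hε0 : 0 < ε := by positivity
  obtain ⟨δ, hδ, hmod⟩ := eventually_norm_boundedGroup_sub_le hk (k i) ε hε0
  have hcol : ∀ᶠ F in atTop, ‖truncation k F (unitVec i) - k i‖ ≤ ε := by
    have := (tendsto_iff_norm_sub_tendsto_zero.1 (tendsto_truncation_unitVec k i))
    exact this.eventually (eventually_le_nhds hε0)
  filter_upwards [Metric.closedBall_mem_nhds t hδ] with t' ht'
  rw [mem_closedBall_iff_norm, Real.norm_eq_abs] at ht'
  have hlim : Tendsto (fun F => inner ℂ (unitVec i) (V t' F f) - inner ℂ (unitVec i) (V t F f)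
      - (t' - t) • (-(Complex.I * inner ℂ (k i) (V t F f)))) 𝒰
      (𝓝 (W t' f i - W t f i - (t' - t) • (-(Complex.I * inner ℂ (k i) (W t f))))) := by
    have h1 := hW2 t' (unitVec i) f
    have h2 := hW2 t (unitVec i) f
    have h3 := hW2 t (k i) f
    rw [inner_unitVec_left] at h1 h2
    exact (h1.sub h2).sub (((h3.const_mul _).neg).const_smul _)
  refine le_of_tendsto hlim.norm (h𝒰 ?_)
  filter_upwards [hmod, hcol] with F hmod hcol
  have hder : ∀ s, HasDerivAt (fun s : ℝ => inner ℂ (unitVec i) (V s F f)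
      - s • (-(Complex.I * inner ℂ (k i) (V t F f))))
      (-(Complex.I * inner ℂ (truncation k F (unitVec i)) (V s F f))
        - (-(Complex.I * inner ℂ (k i) (V t F f)))) s := by
    intro s
    have h1 : HasDerivAt (fun s : ℝ => inner ℂ (unitVec i) (V s F f))
        (-(Complex.I * inner ℂ (truncation k F (unitVec i)) (V s F f))) s := by
      -- The group is moved to the left slot, so that the truncated generator acts on the fixed
      -- basis vector, where it converges to the column `k i`.
      have h2 := (hasDerivAt_boundedGroup (truncation k F) (unitVec i) (-s)).scomp s
        (hasDerivAt_neg s)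
      have h3 := h2.inner ℂ (hasDerivAt_const s f)
      have h4 : ∀ (g : EllTwo I) (s : ℝ), inner ℂ (boundedGroup (truncation k F) (-s) g) f =
          inner ℂ g (V s F f) := fun g s => by
        rw [inner_boundedGroup_left (hsa F), neg_neg]
      simp only [Function.comp_apply, inner_zero_right, zero_add, neg_smul, one_smul, neg_neg,
        inner_smul_left, Complex.conj_I, h4] at h3
      exact h3.congr_deriv (by ring)
    have h2 := h1.sub ((hasDerivAt_id s).smul_const (-(Complex.I * inner ℂ (k i) (V t F f))))
    exact h2.congr_deriv (by rw [one_smul])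
  have hbound : ∀ s ∈ uIcc t t', ‖(-(Complex.I * inner ℂ (truncation k F (unitVec i)) (V s F f))
        - (-(Complex.I * inner ℂ (k i) (V t F f))))‖ ≤ c := by
    intro s hs
    have hst : |t - s| ≤ δ := by
      rw [abs_sub_comm]
      exact (abs_sub_left_of_mem_uIcc hs).trans ht'
    -- The time increment is shifted onto the fixed vector `k i`, where the modulus of continuity
    -- does not depend on the truncation.
    have h1 : inner ℂ (k i) (V s F f) - inner ℂ (k i) (V t F f) =
        inner ℂ (boundedGroup (truncation k F) (t - s) (k i) - k i) (V t F f) := by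
      rw [inner_sub_left, inner_boundedGroup_left (hsa F), ← mul_apply_eq_comp,
        ← boundedGroup_add]
      congr 4
      ring
    have h2 : (-(Complex.I * inner ℂ (truncation k F (unitVec i)) (V s F f))
        - (-(Complex.I * inner ℂ (k i) (V t F f)))) =
        -(Complex.I * (inner ℂ (truncation k F (unitVec i) - k i) (V s F f) +
          inner ℂ (boundedGroup (truncation k F) (t - s) (k i) - k i) (V t F f))) := by
      rw [← h1, inner_sub_left]; ring
    rw [h2, norm_neg, norm_mul, Complex.norm_I, one_mul]
    calc _ ≤ _ := norm_add_le _ _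
      _ ≤ ε * ‖f‖ + ε * ‖f‖ := by
        gcongr
        · refine (norm_inner_le_norm _ _).trans ?_
          rw [hV]
          gcongr
        · refine (norm_inner_le_norm _ _).trans ?_
          rw [hV]
          gcongr
          exact hmod _ hst
      _ ≤ ε * (2 * (‖f‖ + 1)) := by nlinarith
      _ = c := by rw [hε]; field_simp
  have := (convex_uIcc t t').norm_image_sub_le_of_norm_hasDerivWithin_le
    (fun s _ => (hder s).hasDerivWithinAt) hbound left_mem_uIcc right_mem_uIcc
  refine le_trans (le_of_eq ?_) this
  congr 1
  rw [sub_smul]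
  abel

lemma IsWeakSolution.sub {k : I → EllTwo I} {y z : ℝ → EllTwo I} (hy : IsWeakSolution k y)
    (hz : IsWeakSolution k z) : IsWeakSolution k fun t => y t - z t := by
  obtain ⟨C, hC⟩ := hy.bounded
  obtain ⟨C', hC'⟩ := hz.bounded
  refine ⟨⟨C + C', fun t => (norm_sub_le _ _).trans (add_le_add (hC t) (hC' t))⟩, fun i t => ?_⟩
  exact ((hy.deriv i t).sub (hz.deriv i t)).congr_deriv (by rw [inner_sub_right]; ring)

lemma IsWeakSolution.comp_add {k : I → EllTwo I} {y : ℝ → EllTwo I} (hy : IsWeakSolution k y)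
    (s : ℝ) : IsWeakSolution k fun t => y (t + s) := by
  obtain ⟨C, hC⟩ := hy.bounded
  exact ⟨⟨C, fun t => hC _⟩, fun i t => (hy.deriv i (t + s)).comp_add_const t s⟩

lemma IsWeakSolution.eq {k : I → EllTwo I} (hk : MaximalSymmetric k) {y z : ℝ → EllTwo I}
    (hy : IsWeakSolution k y) (hz : IsWeakSolution k z) (h0 : y 0 = z 0) (t : ℝ) : y t = z t :=
  sub_eq_zero.1 ((hy.sub hz).eq_zero hk (sub_eq_zero.2 h0) t)

/-- The maximal operator of a hermitian matrix with square summable columns generates a strongly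
continuous unitary group as soon as it is symmetric. -/
theorem exists_unitaryGroup {k : I → EllTwo I} (hk : ∀ i j, k i j = starRingEnd ℂ (k j i))
    (hsym : MaximalSymmetric k) :
    ∃ W : ℝ → EllTwo I →L[ℂ] EllTwo I, (∀ t, W t ∈ unitary (EllTwo I →L[ℂ] EllTwo I)) ∧
      W 0 = 1 ∧ (∀ s t, W (s + t) = W s * W t) ∧ (∀ f, Continuous fun t => W t f) ∧
      ∀ f g : EllTwo I, (∀ i, inner ℂ (k i) f = g i) ↔
        HasDerivAt (fun t => W t f) (-(Complex.I • g)) 0 := by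
  obtain ⟨W, hW0, hW1, hW⟩ := exists_weakSolutions hk
  have hadd : ∀ s t, W (s + t) = W s * W t := by
    intro s t
    ext1 f
    -- Both sides are weak solutions in `s` with the same value at `s = 0`, so uniqueness gives the
    -- group law.
    refine ((hW f).comp_add t).eq hsym (hW (W t f)) ?_ s
    simp [hW0]
  have hnorm : ∀ t f, ‖W t f‖ = ‖f‖ := by
    intro t f
    refine le_antisymm (hW1 t f) ?_
    have h : W (-t) (W t f) = f := by
      rw [← mul_apply_eq_comp, ← hadd, neg_add_cancel, hW0]; rfl
    calc ‖f‖ = ‖W (-t) (W t f)‖ := by rw [h]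
      _ ≤ _ := hW1 _ _
  have hstar : ∀ t, star (W t) * W t = 1 := fun t =>
    (ContinuousLinearMap.norm_map_iff_adjoint_comp_self _).1 (hnorm t)
  have hinv : ∀ t, W t * W (-t) = 1 := fun t => by rw [← hadd, add_neg_cancel, hW0]
  have hcont : ∀ f, Continuous fun t => W t f := by
    intro f
    refine continuous_iff_continuousAt.2 fun t => ?_
    rw [ContinuousAt, tendsto_iff_norm_sub_tendsto_zero]
    -- Weak continuity together with conservation of the norm gives strong continuity.
    have h1 : Tendsto (fun s => 2 * ‖f‖ ^ 2 - 2 * (inner ℂ (W s f) (W t f)).re) (𝓝 t) (𝓝 0) := by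
      have h2 := ((hW f).continuous_inner (W t f)).tendsto t
      have h3 := ((Complex.continuous_re.tendsto _).comp h2).const_mul 2
      have h4 := h3.const_sub (2 * ‖f‖ ^ 2)
      have h5 : (inner ℂ (W t f) (W t f)).re = ‖f‖ ^ 2 := by
        rw [← hnorm t f]
        exact inner_self_eq_norm_sq (𝕜 := ℂ) _
      rw [h5, sub_self] at h4
      exact h4
    have h6 := h1.sqrt
    rw [Real.sqrt_zero] at h6
    refine h6.congr fun s => ?_
    have h7 := norm_sub_sq (𝕜 := ℂ) (W s f) (W t f)
    rw [hnorm, hnorm, RCLike.re_to_complex] at h7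
    rw [← Real.sqrt_sq (norm_nonneg (W s f - W t f)), h7]
    congr 1
    ring
  refine ⟨W, fun t => Unitary.mem_iff.2 ⟨hstar t, ?_⟩, hW0, hadd, hcont, fun f g => ⟨fun h => ?_, fun h i => ?_⟩⟩
  · have : star (W t) = W (-t) := by
      calc star (W t) = star (W t) * (W t * W (-t)) := by rw [hinv, mul_one]
        _ = W (-t) := by rw [← mul_assoc, hstar, one_mul]
    rw [this, hinv]
  -- If `H f = g`, the candidate `y t = f - i ∫₀ᵗ W s g` satisfies `H (y t) = W t g`, because both
  -- sides have the same derivative and initial value. Hence `y` is a weak solution, its norm is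
  -- conserved by symmetry, and it coincides with `W t f`; its derivative at `0` is visible from the
  -- integral.
  · set y : ℝ → EllTwo I := fun t => f + ∫ s in (0 : ℝ)..t, -(Complex.I • W s g) with hy
    have hcg : Continuous fun s => -(Complex.I • W s g) := ((hcont g).const_smul Complex.I).neg
    have hder : ∀ t, HasDerivAt y (-(Complex.I • W t g)) t := fun t =>
      (intervalIntegral.integral_hasDerivAt_right (hcg.intervalIntegrable 0 t)
        (hcg.stronglyMeasurableAtFilter _ _) hcg.continuousAt).const_add f
    have hcoef : ∀ e t, HasDerivAt (fun t => inner ℂ e (y t))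
        (-(Complex.I * inner ℂ e (W t g))) t := by
      intro e t
      have := (hasDerivAt_const t e).inner ℂ (hder t)
      simpa [inner_neg_right, inner_smul_right] using this
    have hHy : ∀ i t, inner ℂ (k i) (y t) = W t g i := by
      intro i t
      have h1 : ∀ t, HasDerivAt (fun t => inner ℂ (k i) (y t) - W t g i) 0 t := fun t =>
        ((hcoef (k i) t).sub ((hW g).deriv i t)).congr_deriv (sub_self _)
      have h2 := is_const_of_deriv_eq_zero (fun t => (h1 t).differentiableAt)
        (fun t => (h1 t).deriv) t 0
      have h3 : y 0 = f := by simp [hy]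
      rw [h3, h i, hW0] at h2
      exact sub_eq_zero.1 (h2.trans (sub_self (g i)))
    have hy0 : y 0 = f := by simp [hy]
    have hnormy : ∀ t, ‖y t‖ ^ 2 = ‖f‖ ^ 2 := by
      intro t
      have h1 : ∀ t, HasDerivAt (fun t => ‖y t‖ ^ 2) 0 t := by
        intro t
        have h2 := (hder t).inner ℂ (hder t)
        have h3 := Complex.reCLM.hasFDerivAt.comp_hasDerivAt t h2
        have h4 : (inner ℂ (y t) (W t g)).im = 0 := hsym _ _ fun i => hHy i t
        have h5 : (inner ℂ (W t g) (y t)).im = 0 := by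
          rw [← inner_conj_symm, Complex.conj_im, h4, neg_zero]
        refine (h3.congr_deriv ?_).congr_of_eventuallyEq (Eventually.of_forall fun s => ?_)
        · simp [inner_neg_right, inner_neg_left, inner_smul_right, inner_smul_left, h4, h5]
        · exact (inner_self_eq_norm_sq (𝕜 := ℂ) (y s)).symm
      have h2 := is_const_of_deriv_eq_zero (fun t => (h1 t).differentiableAt)
        (fun t => (h1 t).deriv) t 0
      rwa [hy0] at h2
    have hyweak : IsWeakSolution k y := by
      refine ⟨⟨‖f‖, fun t => ?_⟩, fun i t => ?_⟩
      · exact ((sq_eq_sq₀ (norm_nonneg _) (norm_nonneg _)).1 (hnormy t)).le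
      · have := hcoef (unitVec i) t
        simp only [inner_unitVec_left] at this
        rwa [hHy i t]
    have hloc : ∀ t, y t = W t f := fun t => hyweak.eq hsym (hW f) (by rw [hy0, hW0]; rfl) t
    have := hder 0
    rw [hW0] at this
    exact this.congr_of_eventuallyEq (Eventually.of_forall fun t => (hloc t).symm)
  -- Conversely, the coefficients of a strong derivative must agree with those prescribed by the
  -- weak equation.
  · have h1 := (hasDerivAt_const (0 : ℝ) (unitVec i : EllTwo I)).inner ℂ h
    have h2 := (hW f).deriv i 0
    simp only [inner_zero_left, add_zero, inner_unitVec_left] at h1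
    have h3 := h2.unique h1
    rw [hW0] at h3
    simp only [lp.coeFn_neg, lp.coeFn_smul, Pi.neg_apply, Pi.smul_apply, smul_eq_mul, neg_inj] at h3
    exact mul_left_cancel₀ Complex.I_ne_zero h3

end MatrixGenerator

/-! ### The Hamiltonian as a hermitian matrix in the occupation number basis. -/

section Hamiltonian

variable {d : ℕ} {Λ : Set (EuclideanSpace ℝ (Fin d))}

/-- The hopping matrix without its diagonal. -/
def offDiag (h : Λ → Λ → ℂ) (x y : Λ) : ℂ :=
  haveI := Classical.dec (x = y)
  if x = y then 0 else h x y

lemma offDiag_self (h : Λ → Λ → ℂ) (x : Λ) : offDiag h x x = 0 := by simp [offDiag]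

lemma offDiag_of_ne (h : Λ → Λ → ℂ) {x y : Λ} (hxy : x ≠ y) : offDiag h x y = h x y := by
  simp [offDiag, hxy]

lemma offDiag_star {h : Λ → Λ → ℂ} (hh : ∀ x y, h x y = star (h y x)) (x y : Λ) :
    offDiag h x y = starRingEnd ℂ (offDiag h y x) := by
  by_cases hxy : x = y
  · subst hxy; simp [offDiag_self]
  · rw [offDiag_of_ne h hxy, offDiag_of_ne h (Ne.symm hxy), hh x y]; rfl

lemma enorm_offDiag_le (h : Λ → Λ → ℂ) (x y : Λ) : ‖offDiag h x y‖ₑ ≤ ‖h x y‖ₑ := by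
  by_cases hxy : x = y
  · subst hxy; simp [offDiag_self]
  · rw [offDiag_of_ne h hxy]

lemma enorm_offDiag_symm {h : Λ → Λ → ℂ} (hh : ∀ x y, h x y = star (h y x)) (x y : Λ) :
    ‖offDiag h x y‖ₑ = ‖offDiag h y x‖ₑ := by
  rw [offDiag_star hh, ← ofReal_norm, ← ofReal_norm, RCLike.norm_conj]

/-- The spacing of the lattice lets the moment dominate the entry itself. On the diagonal the
distance vanishes, so the moments say nothing about `h x x`; this is why the diagonal is split off.
-/
lemma enorm_offDiag_mul_le (h : Λ → Λ → ℂ) (hΛ : Λ.Pairwise fun x y => 1 ≤ dist x y) (x y : Λ) :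
    ‖offDiag h x y‖ₑ ≤ ENNReal.ofReal (‖h x y‖ * dist x y ^ (0 + 1)) := by
  by_cases hxy : x = y
  · subst hxy; simp [offDiag_self]
  · rw [offDiag_of_ne h hxy, ← ofReal_norm]
    have : 1 ≤ dist x y := hΛ x.2 y.2 fun h => hxy (Subtype.ext h)
    refine ENNReal.ofReal_le_ofReal ?_
    rw [zero_add, pow_one]
    exact le_mul_of_one_le_right (norm_nonneg _) this

lemma tsum_enorm_offDiag_le {h : Λ → Λ → ℂ} (hΛ : Λ.Pairwise fun x y => 1 ≤ dist x y) (x : Λ) :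
    ∑' y, ‖offDiag h x y‖ₑ ≤ hopMoment h 0 :=
  (ENNReal.tsum_le_tsum fun y => enorm_offDiag_mul_le h hΛ x y).trans
    (le_iSup (fun x : Λ => ∑' y : Λ, ENNReal.ofReal (‖h x y‖ * dist x y ^ (0 + 1))) x)

lemma add_single_sub_single (σ : Config Λ) (x : Λ) :
    σ + Finsupp.single x 1 - Finsupp.single x 1 = σ := by
  simp

lemma sub_single_add_single {σ : Config Λ} {x : Λ} (hx : σ x ≠ 0) :
    σ - Finsupp.single x 1 + Finsupp.single x 1 = σ := by
  refine tsub_add_cancel_of_le ?_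
  rw [Finsupp.single_le_iff]
  omega

/-- The matrix element of `a*_x a_y` out of `hopTarget σ (x, y)` into `σ`. -/
def hopCoeff (σ : Config Λ) (p : Λ × Λ) : ℝ :=
  Real.sqrt (σ p.1) * Real.sqrt (((σ - Finsupp.single p.1 1 : Config Λ) p.2 : ℝ) + 1)

/-- The configuration `σ` with a particle moved from `x` to `y`. -/
def hopTarget (σ : Config Λ) (p : Λ × Λ) : Config Λ :=
  σ - Finsupp.single p.1 1 + Finsupp.single p.2 1

lemma create_annihilate (σ : Config Λ) (p : Λ × Λ) (ψ : Config Λ → ℂ) :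
    create p.1 (annihilate p.2 ψ) σ = hopCoeff σ p * ψ (hopTarget σ p) := by
  simp only [create, annihilate, hopCoeff, hopTarget]
  push_cast
  ring

lemma sqrt_mul_sqrt_cast (m : ℕ) : (Real.sqrt (m : ℝ) : ℂ) * (Real.sqrt (m : ℝ) : ℂ) = m := by
  rw [← Complex.ofReal_mul, Real.mul_self_sqrt (Nat.cast_nonneg m)]
  simp

lemma create_annihilate_self (σ : Config Λ) (x : Λ) (ψ : Config Λ → ℂ) :
    create x (annihilate x ψ) σ = (σ x : ℂ) * ψ σ := by
  simp only [create, annihilate]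
  by_cases hx : σ x = 0
  · simp [hx]
  · rw [sub_single_add_single hx]
    have h1 : (((σ - Finsupp.single x 1 : Config Λ) x : ℕ) : ℝ) + 1 = (σ x : ℕ) := by
      have : (σ - Finsupp.single x 1 : Config Λ) x + 1 = σ x := by
        rw [Finsupp.tsub_apply, Finsupp.single_eq_same]; omega
      exact_mod_cast this
    rw [h1, ← mul_assoc, sqrt_mul_sqrt_cast]

lemma create_create_annihilate_annihilate (σ : Config Λ) (x y : Λ) (ψ : Config Λ → ℂ) :
    create x (create y (annihilate y (annihilate x ψ))) σ =
      (((σ x : ℝ) * ((σ - Finsupp.single x 1 : Config Λ) y : ℕ) : ℝ) : ℂ) * ψ σ := by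
  have h1 : create x (create y (annihilate y (annihilate x ψ))) σ =
      (Real.sqrt (σ x : ℝ) : ℂ) * (create y (annihilate y (annihilate x ψ)))
        (σ - Finsupp.single x 1) := rfl
  rw [h1, create_annihilate_self]
  have h2 := create_annihilate_self σ x ψ
  simp only [create] at h2
  push_cast
  rw [mul_left_comm, h2]
  ring

/-- The diagonal part of the Hamiltonian: the on-site hopping terms and the interaction. -/
def diagEnergy (h : Λ → Λ → ℂ) (v : Λ → Λ → ℝ) (σ : Config Λ) : ℝ :=
  ∑ x ∈ σ.support, (h x x).re * σ x +
    1 / 2 * ∑ p ∈ σ.support ×ˢ σ.support,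
      v p.1 p.2 * (σ p.1 * ((σ - Finsupp.single p.1 1 : Config Λ) p.2 : ℕ))

lemma hopCoeff_le (σ : Config Λ) (p : Λ × Λ) :
    hopCoeff σ p ≤ Real.sqrt (σ p.1) * Real.sqrt (σ.degree + 1) := by
  unfold hopCoeff
  gcongr
  calc (σ - Finsupp.single p.1 1 : Config Λ) p.2 ≤ σ p.2 := by
        rw [Finsupp.tsub_apply]; exact Nat.sub_le _ _
    _ ≤ σ.degree := Finsupp.le_degree _ _

lemma summable_offDiag_hopCoeff {h : Λ → Λ → ℂ} {K : ℝ≥0}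
    (hK : ∀ x, ∑' y, ‖offDiag h x y‖ₑ ≤ K) (σ : Config Λ) :
    Summable fun p : Λ × Λ => ‖offDiag h p.1 p.2‖ * hopCoeff σ p := by
  have hnn : ∀ p, 0 ≤ hopCoeff σ p := fun p => by unfold hopCoeff; positivity
  refine Summable.of_enorm (ne_top_of_le_ne_top ?_ (ENNReal.tsum_le_tsum fun p : Λ × Λ =>
    (?_ : _ ≤ ‖offDiag h p.1 p.2‖ₑ * ENNReal.ofReal (Real.sqrt (σ p.1) *
      Real.sqrt (σ.degree + 1)))))
  · rw [ENNReal.tsum_prod']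
    simp_rw [ENNReal.tsum_mul_right]
    refine ne_top_of_le_ne_top ?_ (ENNReal.tsum_le_tsum fun x => mul_le_mul_left (hK x) _)
    rw [tsum_eq_sum (s := σ.support)]
    · exact (ENNReal.sum_lt_top.2 fun x _ =>
        ENNReal.mul_lt_top ENNReal.coe_lt_top ENNReal.ofReal_lt_top).ne
    · intro x hx
      simp [Finsupp.notMem_support_iff.1 hx]
  · rw [enorm_mul, enorm_norm, Real.enorm_of_nonneg (hnn p)]
    gcongr
    exact hopCoeff_le σ p

lemma hamiltonian_eq {h : Λ → Λ → ℂ} (hh : ∀ x y, h x y = star (h y x)) (v : Λ → Λ → ℝ) {K : ℝ≥0}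
    (hK : ∀ x, ∑' y, ‖offDiag h x y‖ₑ ≤ K) (ψ : Fock Λ) (σ : Config Λ) :
    hamiltonian h v ψ σ =
      ∑' p : Λ × Λ, offDiag h p.1 p.2 * create p.1 (annihilate p.2 ψ) σ +
        diagEnergy h v σ * ψ σ := by
  classical
  have h1 : Summable fun p : Λ × Λ => offDiag h p.1 p.2 * create p.1 (annihilate p.2 ψ) σ := by
    refine Summable.of_norm_bounded ((summable_offDiag_hopCoeff hK σ).mul_right ‖ψ‖) fun p => ?_
    rw [create_annihilate, norm_mul, norm_mul, ← mul_assoc, Complex.norm_real, Real.norm_of_nonneg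
      (by unfold hopCoeff; positivity)]
    gcongr
    · unfold hopCoeff; positivity
    · exact lp.norm_apply_le_norm (by norm_num) _ _
  have hdiag : ∀ x, (h x x : ℂ) = ((h x x).re : ℂ) := fun x => by
    have := hh x x
    exact (Complex.conj_eq_iff_re.1 this.symm).symm
  -- The removed diagonal acts only on occupied sites, hence through a finite sum.
  let D : Finset (Λ × Λ) := σ.support.map ⟨fun x => (x, x), fun x y hxy => (Prod.mk.inj hxy).1⟩
  have h2 : HasSum (fun p : Λ × Λ => (h p.1 p.2 - offDiag h p.1 p.2) *
      create p.1 (annihilate p.2 ψ) σ) (∑ x ∈ σ.support, ((h x x).re * σ x : ℝ) * ψ σ) := by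
    have h3 : ∑ x ∈ σ.support, ((h x x).re * σ x : ℝ) * ψ σ =
        ∑ p ∈ D, (h p.1 p.2 - offDiag h p.1 p.2) * create p.1 (annihilate p.2 ψ) σ := by
      rw [Finset.sum_map]
      refine Finset.sum_congr rfl fun x _ => ?_
      change _ = (h x x - offDiag h x x) * create x (annihilate x ψ) σ
      rw [offDiag_self, sub_zero, create_annihilate_self]
      push_cast
      rw [← hdiag, mul_assoc]
    rw [h3]
    refine hasSum_sum_of_ne_finset_zero fun p hp => ?_
    by_cases hxy : p.1 = p.2
    · have hx : σ p.1 = 0 := by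
        by_contra hne
        refine hp (Finset.mem_map.2 ⟨p.1, Finsupp.mem_support_iff.2 hne, ?_⟩)
        exact Prod.ext rfl hxy
      simp [create, hx]
    · rw [offDiag_of_ne h hxy, sub_self, zero_mul]
  have h3 := h1.hasSum.add h2
  have h4 : ∑' p : Λ × Λ, h p.1 p.2 * create p.1 (annihilate p.2 ψ) σ = _ :=
    (h3.congr_fun fun p => by ring).tsum_eq
  have h5 : ∑' p : Λ × Λ,
      (v p.1 p.2 : ℂ) * create p.1 (create p.2 (annihilate p.2 (annihilate p.1 ψ))) σ =
      ∑ p ∈ σ.support ×ˢ σ.support,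
        ((v p.1 p.2 * (σ p.1 * ((σ - Finsupp.single p.1 1 : Config Λ) p.2 : ℕ)) : ℝ) : ℂ) * ψ σ := by
    simp_rw [create_create_annihilate_annihilate]
    rw [tsum_eq_sum (s := σ.support ×ˢ σ.support)]
    · refine Finset.sum_congr rfl fun p _ => ?_
      push_cast
      ring
    · intro p hp
      rw [Finset.mem_product, not_and_or, Finsupp.notMem_support_iff,
        Finsupp.notMem_support_iff] at hp
      rcases hp with hp | hp
      · simp [hp]
      · simp [Finsupp.tsub_apply, hp]
  rw [hamiltonian, h4, h5, diagEnergy, ← Finset.sum_mul, ← Finset.sum_mul]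
  push_cast
  ring

/-- The columns of the Hamiltonian in the occupation number basis. -/
def hamiltonianColumn (h : Λ → Λ → ℂ) (v : Λ → Λ → ℝ) (σ : Config Λ) : Fock Λ :=
  ∑' p : Λ × Λ, (starRingEnd ℂ (offDiag h p.1 p.2) * hopCoeff σ p) • unitVec (hopTarget σ p) +
    (diagEnergy h v σ : ℂ) • unitVec σ

lemma summable_hopping {h : Λ → Λ → ℂ} {K : ℝ≥0}
    (hK : ∀ x, ∑' y, ‖offDiag h x y‖ₑ ≤ K) (σ : Config Λ) :
    Summable fun p : Λ × Λ =>
      (starRingEnd ℂ (offDiag h p.1 p.2) * hopCoeff σ p) • (unitVec (hopTarget σ p) : Fock Λ) := by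
  refine Summable.of_norm_bounded (summable_offDiag_hopCoeff hK σ) fun p => ?_
  rw [norm_smul, norm_unitVec, mul_one, norm_mul, RCLike.norm_conj, Complex.norm_real,
    Real.norm_of_nonneg (by unfold hopCoeff; positivity)]

lemma inner_hamiltonianColumn {h : Λ → Λ → ℂ} (hh : ∀ x y, h x y = star (h y x))
    (v : Λ → Λ → ℝ) {K : ℝ≥0} (hK : ∀ x, ∑' y, ‖offDiag h x y‖ₑ ≤ K) (ψ : Fock Λ)
    (σ : Config Λ) : inner ℂ (hamiltonianColumn h v σ) ψ = hamiltonian h v ψ σ := by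
  rw [hamiltonian_eq hh v hK, hamiltonianColumn, inner_add_left]
  congr 1
  · have h1 := ((summable_hopping hK σ).hasSum.mapL (innerSL ℂ ψ)).tsum_eq
    simp only [innerSL_apply_apply] at h1
    rw [← inner_conj_symm, ← h1, Complex.conj_tsum]
    refine tsum_congr fun p => ?_
    rw [create_annihilate, inner_conj_symm, inner_smul_left, inner_unitVec_left]
    simp [mul_assoc]
  · rw [inner_smul_left, inner_unitVec_left, Complex.conj_ofReal]

lemma hamiltonianColumn_apply {h : Λ → Λ → ℂ} (v : Λ → Λ → ℝ) {K : ℝ≥0}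
    (hK : ∀ x, ∑' y, ‖offDiag h x y‖ₑ ≤ K) (σ τ : Config Λ) :
    hamiltonianColumn h v σ τ =
      ∑' p : Λ × Λ, starRingEnd ℂ (offDiag h p.1 p.2) * hopCoeff σ p *
        (unitVec (hopTarget σ p) : Fock Λ) τ + diagEnergy h v σ * (unitVec σ : Fock Λ) τ := by
  have h1 := ((summable_hopping hK σ).hasSum.mapL (innerSL ℂ (unitVec τ))).tsum_eq
  simp only [innerSL_apply_apply] at h1
  rw [hamiltonianColumn, ← inner_unitVec_left τ, inner_add_right, ← h1, inner_smul_right]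
  simp only [inner_smul_right, inner_unitVec_left]

/-- A hop and its reverse have the same matrix element. When the source site is empty the truncated
subtraction makes `hopTarget` meaningless, but then `hopCoeff` vanishes. -/
lemma hopCoeff_unitVec_symm (σ τ : Config Λ) (x y : Λ) :
    (hopCoeff σ (x, y) : ℂ) * (unitVec (hopTarget σ (x, y)) : Fock Λ) τ =
      hopCoeff τ (y, x) * (unitVec (hopTarget τ (y, x)) : Fock Λ) σ := by
  classical
  have key : ∀ (σ τ : Config Λ) (x y : Λ), σ x ≠ 0 → τ = hopTarget σ (x, y) →
      σ = hopTarget τ (y, x) ∧ τ y ≠ 0 ∧ hopCoeff τ (y, x) = hopCoeff σ (x, y) := by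
    intro σ τ x y hx hτ
    simp only [hopTarget] at hτ
    have h1 : τ - Finsupp.single y 1 = σ - Finsupp.single x 1 := by
      rw [hτ, add_single_sub_single]
    refine ⟨?_, ?_, ?_⟩
    · simp only [hopTarget, h1]
      rw [sub_single_add_single hx]
    · rw [hτ]; simp
    · simp only [hopCoeff, h1]
      have h2 : ((σ - Finsupp.single x 1 : Config Λ) x : ℝ) + 1 = σ x := by
        have : (σ - Finsupp.single x 1 : Config Λ) x + 1 = σ x := by
          rw [Finsupp.tsub_apply, Finsupp.single_eq_same]; omega
        exact_mod_cast this
      have h3 : (τ y : ℝ) = (σ - Finsupp.single x 1 : Config Λ) y + 1 := by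
        rw [hτ, Finsupp.add_apply, Finsupp.single_eq_same]; push_cast; ring
      rw [h2, h3, mul_comm]
  have hzero : ∀ (σ : Config Λ) (x y : Λ), σ x = 0 → hopCoeff σ (x, y) = 0 := by
    intro σ x y hx
    simp [hopCoeff, hx]
  by_cases hA : σ x ≠ 0 ∧ τ = hopTarget σ (x, y)
  · obtain ⟨h1, -, h3⟩ := key σ τ x y hA.1 hA.2
    rw [← hA.2, ← h1, unitVec_self, unitVec_self, h3]
  · by_cases hB : τ y ≠ 0 ∧ σ = hopTarget τ (y, x)
    · obtain ⟨h1, h2, -⟩ := key τ σ y x hB.1 hB.2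
      exact absurd ⟨h2, h1⟩ hA
    · have : ∀ (σ τ : Config Λ) (x y : Λ), ¬(σ x ≠ 0 ∧ τ = hopTarget σ (x, y)) →
          (hopCoeff σ (x, y) : ℂ) * (unitVec (hopTarget σ (x, y)) : Fock Λ) τ = 0 := by
        intro σ τ x y hne
        by_cases hx : σ x = 0
        · simp [hzero σ x y hx]
        · rw [unitVec_ne fun h => hne ⟨hx, h⟩, mul_zero]
      rw [this _ _ _ _ hA, this _ _ _ _ hB]

lemma hamiltonianColumn_symm {h : Λ → Λ → ℂ} (hh : ∀ x y, h x y = star (h y x))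
    (v : Λ → Λ → ℝ) {K : ℝ≥0} (hK : ∀ x, ∑' y, ‖offDiag h x y‖ₑ ≤ K) (σ τ : Config Λ) :
    hamiltonianColumn h v σ τ = starRingEnd ℂ (hamiltonianColumn h v τ σ) := by
  classical
  rw [hamiltonianColumn_apply v hK, hamiltonianColumn_apply v hK, map_add]
  have hreal : ∀ σ τ : Config Λ, starRingEnd ℂ ((unitVec σ : Fock Λ) τ) = (unitVec σ : Fock Λ) τ := by
    intro σ τ
    by_cases h : τ = σ
    · rw [h, unitVec_self, map_one]
    · rw [unitVec_ne h, map_zero]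
  congr 1
  · rw [Complex.conj_tsum, ← (Equiv.prodComm Λ Λ).tsum_eq]
    refine tsum_congr fun p => ?_
    simp only [Equiv.prodComm_apply, Prod.fst_swap, Prod.snd_swap, map_mul, hreal,
      Complex.conj_ofReal, mul_assoc]
    rw [← offDiag_star hh, ← hopCoeff_unitVec_symm, Complex.conj_conj]
    rfl
  · by_cases hστ : σ = τ
    · subst hστ; simp [hreal]
    · rw [unitVec_ne (Ne.symm hστ), unitVec_ne hστ]; simp

end Hamiltonian

/-! ### The commutator of the Hamiltonian with diagonal observables. -/

section Current

variable {d : ℕ} {Λ : Set (EuclideanSpace ℝ (Fin d))}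

lemma tsum_enorm_sq (ψ : Fock Λ) : ∑' σ, ‖ψ σ‖ₑ ^ 2 = ‖ψ‖ₑ ^ 2 := by
  have h := lp.hasSum_norm (p := 2) (by norm_num) ψ
  simp only [ENNReal.toReal_ofNat, Real.rpow_ofNat] at h
  have h2 := ENNReal.ofReal_tsum_of_nonneg (fun σ => by positivity) h.summable
  rw [h.tsum_eq] at h2
  simp_rw [← ofReal_norm]
  rw [← ENNReal.ofReal_pow (norm_nonneg _), h2]
  exact tsum_congr fun σ => (ENNReal.ofReal_pow (norm_nonneg _) _).symm

/-- Configurations with a particle at `x` are parametrized by removing it; in the variable `τ` a hop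
from `x` to `y` links `τ + δ_x` with `τ + δ_y`, and the two sites play symmetric roles. -/
lemma tsum_add_single {M : Type*} [AddCommMonoid M] [TopologicalSpace M] (x : Λ)
    {g : Config Λ → M} (hg : ∀ σ, σ x = 0 → g σ = 0) :
    ∑' τ, g (τ + Finsupp.single x 1) = ∑' σ, g σ := by
  refine (add_left_injective (Finsupp.single x 1)).tsum_eq fun σ hσ => ?_
  have hx : σ x ≠ 0 := fun h => hσ (hg σ h)
  exact ⟨σ - Finsupp.single x 1, sub_single_add_single hx⟩

lemma enorm_annihilate_sq (x : Λ) (ψ : Config Λ → ℂ) (τ : Config Λ) :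
    ‖annihilate x ψ τ‖ₑ ^ 2 =
      ((τ + Finsupp.single x 1 : Config Λ) x : ℕ) * ‖ψ (τ + Finsupp.single x 1)‖ₑ ^ 2 := by
  rw [annihilate, enorm_mul, mul_pow]
  congr 1
  rw [← ofReal_norm, Complex.norm_real, Real.norm_of_nonneg (by positivity),
    ← ENNReal.ofReal_pow (by positivity), Real.sq_sqrt (by positivity), Finsupp.add_apply,
    Finsupp.single_eq_same, ← ENNReal.ofReal_natCast]
  push_cast
  rfl

lemma tsum_enorm_annihilate_sq (ψ : Config Λ → ℂ) (g : Λ → Config Λ → ℝ≥0∞) :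
    ∑' x : Λ, ∑' τ, g x (τ + Finsupp.single x 1) * ‖annihilate x ψ τ‖ₑ ^ 2 =
      ∑' σ : Config Λ, (∑' x : Λ, g x σ * (σ x : ℕ)) * ‖ψ σ‖ₑ ^ 2 := by
  have h1 : ∀ x : Λ, ∑' τ, g x (τ + Finsupp.single x 1) * ‖annihilate x ψ τ‖ₑ ^ 2 =
      ∑' σ : Config Λ, g x σ * (σ x : ℕ) * ‖ψ σ‖ₑ ^ 2 := by
    intro x
    simp_rw [enorm_annihilate_sq, ← mul_assoc]
    exact tsum_add_single x (g := fun σ => g x σ * (σ x : ℕ) * ‖ψ σ‖ₑ ^ 2)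
      fun σ hσ => by simp [hσ]
  simp_rw [h1]
  rw [ENNReal.tsum_comm]
  exact tsum_congr fun σ => ENNReal.tsum_mul_right

lemma tsum_natCast_eq_degree (σ : Config Λ) : ∑' x : Λ, ((σ x : ℕ) : ℝ≥0∞) = (σ.degree : ℕ) := by
  rw [tsum_eq_sum (s := σ.support), Finsupp.degree_apply]
  · push_cast; rfl
  · intro x hx
    simp [Finsupp.notMem_support_iff.1 hx]

/-- Schur test: by symmetry of `m` the two halves are equal, and each is controlled by the row sums.
-/
lemma schur_le {ι : Type*} {m : ι → ι → ℝ≥0∞} (hm : ∀ x y, m x y = m y x) {L : ℝ≥0∞}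
    (hL : ∀ x, ∑' y, m x y ≤ L) (u : ι → ℝ≥0∞) :
    ∑' p : ι × ι, m p.1 p.2 * (u p.1 + u p.2) ≤ 2 * (L * ∑' x, u x) := by
  have h1 : ∑' p : ι × ι, m p.1 p.2 * u p.1 ≤ L * ∑' x, u x := by
    rw [ENNReal.tsum_prod', ← ENNReal.tsum_mul_left]
    refine ENNReal.tsum_le_tsum fun x => ?_
    simp only
    rw [ENNReal.tsum_mul_right]
    gcongr
    exact hL x
  have h2 : ∑' p : ι × ι, m p.1 p.2 * u p.2 = ∑' p : ι × ι, m p.1 p.2 * u p.1 := by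
    rw [← (Equiv.prodComm ι ι).tsum_eq]
    refine tsum_congr fun p => ?_
    simp only [Equiv.prodComm_apply, Prod.fst_swap, Prod.snd_swap]
    rw [hm]
  simp_rw [mul_add]
  rw [ENNReal.tsum_add, h2, two_mul]
  gcongr

/-- The indicator of the configurations with at most `M` particles. -/
def cutoff (M : ℕ) (σ : Config Λ) : ℝ≥0 := if σ.degree ≤ M then 1 else 0

lemma tsum_cutoff_annihilate_lt_top (ψ : Fock Λ) (M : ℕ) :
    ∑' x : Λ, ∑' τ, (cutoff M (τ + Finsupp.single x 1) : ℝ≥0∞) * ‖annihilate x ψ τ‖ₑ ^ 2 < ∞ := by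
  rw [tsum_enorm_annihilate_sq ψ fun _ σ => (cutoff M σ : ℝ≥0∞)]
  calc _ ≤ ∑' σ : Config Λ, (M : ℝ≥0∞) * ‖ψ σ‖ₑ ^ 2 := by
        refine ENNReal.tsum_le_tsum fun σ => ?_
        gcongr
        rw [ENNReal.tsum_mul_left, tsum_natCast_eq_degree, cutoff]
        split_ifs with hM
        · simpa using hM
        · simp
    _ = M * ‖ψ‖ₑ ^ 2 := by rw [ENNReal.tsum_mul_left, tsum_enorm_sq]
    _ < ∞ := ENNReal.mul_lt_top (ENNReal.natCast_lt_top M) (by simp)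

lemma enorm_mul_le_add_sq (a b : ℂ) : ‖a‖ₑ * ‖b‖ₑ ≤ ‖a‖ₑ ^ 2 + ‖b‖ₑ ^ 2 := by
  rcases le_total ‖a‖ₑ ‖b‖ₑ with h | h
  · exact (mul_le_mul_left h _).trans (by rw [← pow_two]; exact le_add_self)
  · exact (mul_le_mul_right h _).trans (by rw [← pow_two]; exact le_self_add)

lemma degree_add_single (τ : Config Λ) (x : Λ) :
    (τ + Finsupp.single x 1).degree = τ.degree + 1 := by
  rw [map_add, Finsupp.degree_single]

lemma cutoff_add_single (M : ℕ) (τ : Config Λ) (x y : Λ) :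
    cutoff M (τ + Finsupp.single x 1) = cutoff M (τ + Finsupp.single y 1) := by
  simp only [cutoff, degree_add_single]

variable {h : Λ → Λ → ℂ} {v : Λ → Λ → ℝ} {K : ℝ≥0}

/-- The matrix elements of the hopping, weighted by `A`, between configurations that arise by
adding a particle to a common configuration `τ`. -/
def hopTerm (h : Λ → Λ → ℂ) (A : Config Λ → ℝ) (ψ : Config Λ → ℂ) (p : Λ × Λ) (τ : Config Λ) : ℂ :=
  A (τ + Finsupp.single p.1 1) *
    (offDiag h p.1 p.2 * (starRingEnd ℂ (annihilate p.1 ψ τ) * annihilate p.2 ψ τ))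

/-- Absolute convergence, which licenses all later exchanges of sums. The cutoff makes the total of
`‖a_x ψ‖²` finite, and the Schur test handles the hopping matrix. -/
lemma tsum_enorm_hopTerm_lt_top (hh : ∀ x y, h x y = star (h y x))
    (hK : ∀ x, ∑' y, ‖offDiag h x y‖ₑ ≤ K) {A : Config Λ → ℝ} {M : ℕ} {B : ℝ≥0}
    (hA : ∀ σ, ‖A σ‖ₑ ≤ B * cutoff M σ) (ψ : Fock Λ) :
    ∑' p : Λ × Λ, ∑' τ, ‖hopTerm h A ψ p τ‖ₑ < ∞ := by
  let u : Λ → ℝ≥0∞ := fun x =>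
    ∑' τ, (cutoff M (τ + Finsupp.single x 1) : ℝ≥0∞) * ‖annihilate x ψ τ‖ₑ ^ 2
  calc _ ≤ ∑' p : Λ × Λ, B * (‖offDiag h p.1 p.2‖ₑ * (u p.1 + u p.2)) := by
        refine ENNReal.tsum_le_tsum fun p => ?_
        simp only [u]
        rw [← ENNReal.tsum_add, ← ENNReal.tsum_mul_left, ← ENNReal.tsum_mul_left]
        refine ENNReal.tsum_le_tsum fun τ => ?_
        rw [cutoff_add_single M τ p.2 p.1, ← mul_add, hopTerm, enorm_mul, enorm_mul, enorm_mul]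
        have h1 : ‖((A (τ + Finsupp.single p.1 1) : ℝ) : ℂ)‖ₑ = ‖A (τ + Finsupp.single p.1 1)‖ₑ := by
          rw [← ofReal_norm, Complex.norm_real, ofReal_norm]
        have h2 : ‖starRingEnd ℂ (annihilate p.1 ψ τ)‖ₑ = ‖annihilate p.1 ψ τ‖ₑ := by
          rw [← ofReal_norm, RCLike.norm_conj, ofReal_norm]
        rw [h1, h2]
        calc _ ≤ (B * cutoff M (τ + Finsupp.single p.1 1)) * (‖offDiag h p.1 p.2‖ₑ *
              (‖annihilate p.1 ψ τ‖ₑ ^ 2 + ‖annihilate p.2 ψ τ‖ₑ ^ 2)) := by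
              gcongr
              · exact hA _
              · exact enorm_mul_le_add_sq _ _
          _ = _ := by ring
    _ ≤ B * (2 * (K * ∑' x, u x)) := by
        rw [ENNReal.tsum_mul_left]
        gcongr
        exact schur_le (enorm_offDiag_symm hh) hK u
    _ < ∞ := ENNReal.mul_lt_top ENNReal.coe_lt_top (ENNReal.mul_lt_top (by simp)
        (ENNReal.mul_lt_top ENNReal.coe_lt_top (tsum_cutoff_annihilate_lt_top ψ M)))

/-- The pairing of `ψ` with the hopping term of the Hamiltonian, weighted by `A`. -/
def siteTerm (h : Λ → Λ → ℂ) (A : Config Λ → ℝ) (ψ : Config Λ → ℂ) (p : Λ × Λ) (σ : Config Λ) : ℂ :=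
  A σ * (starRingEnd ℂ (ψ σ) * (offDiag h p.1 p.2 * create p.1 (annihilate p.2 ψ) σ))

lemma siteTerm_add_single (A : Config Λ → ℝ) (ψ : Config Λ → ℂ) (p : Λ × Λ) (τ : Config Λ) :
    siteTerm h A ψ p (τ + Finsupp.single p.1 1) = hopTerm h A ψ p τ := by
  have h1 : create p.1 (annihilate p.2 ψ) (τ + Finsupp.single p.1 1) =
      (Real.sqrt ((τ p.1 : ℝ) + 1) : ℂ) * annihilate p.2 ψ τ := by
    simp only [create, add_single_sub_single, Finsupp.add_apply, Finsupp.single_eq_same]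
    push_cast
    rfl
  rw [siteTerm, hopTerm, h1]
  simp only [annihilate, map_mul, Complex.conj_ofReal]
  ring

lemma siteTerm_eq_zero (A : Config Λ → ℝ) (ψ : Config Λ → ℂ) (p : Λ × Λ) {σ : Config Λ}
    (hσ : σ p.1 = 0) : siteTerm h A ψ p σ = 0 := by
  simp [siteTerm, create, hσ]

/-- Exchanging the two sites conjugates the hopping amplitude and changes the weight from its value
at `τ + δ_x` to that at `τ + δ_y`. Adding the sum to its swapped copy leaves the discrete gradient
of `A` times the imaginary part of the amplitude. -/
lemma two_mul_im_tsum_siteTerm (hh : ∀ x y, h x y = star (h y x))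
    (hK : ∀ x, ∑' y, ‖offDiag h x y‖ₑ ≤ K) {A : Config Λ → ℝ} {M : ℕ} {B : ℝ≥0}
    (hA : ∀ σ, ‖A σ‖ₑ ≤ B * cutoff M σ) (ψ : Fock Λ) :
    2 * (∑' σ, ∑' p, siteTerm h A ψ p σ).im = ∑' p : Λ × Λ, ∑' τ,
      (A (τ + Finsupp.single p.1 1) - A (τ + Finsupp.single p.2 1)) *
        (offDiag h p.1 p.2 * (starRingEnd ℂ (annihilate p.1 ψ τ) * annihilate p.2 ψ τ)).im := by
  have hfin := (tsum_enorm_hopTerm_lt_top hh hK hA ψ).ne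
  have hs1 : Summable fun q : (Λ × Λ) × Config Λ => hopTerm h A ψ q.1 q.2 := by
    refine Summable.of_enorm ?_
    rwa [ENNReal.tsum_prod']
  have hs2 : Summable fun q : (Λ × Λ) × Config Λ => siteTerm h A ψ q.1 q.2 := by
    refine Summable.of_enorm ?_
    rw [ENNReal.tsum_prod']
    convert hfin using 3 with p
    rw [← tsum_add_single p.1 fun σ hσ => by simp [siteTerm_eq_zero A ψ p hσ]]
    simp_rw [siteTerm_add_single]
  have h1 : ∑' σ, ∑' p, siteTerm h A ψ p σ = ∑' p, ∑' τ, hopTerm h A ψ p τ := by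
    refine (Summable.tsum_comm (f := fun p σ => siteTerm h A ψ p σ) hs2).trans
      (tsum_congr fun p => ?_)
    rw [← tsum_add_single p.1 fun σ hσ => siteTerm_eq_zero A ψ p hσ]
    simp_rw [siteTerm_add_single]
  let e : (Λ × Λ) × Config Λ ≃ (Λ × Λ) × Config Λ := (Equiv.prodComm Λ Λ).prodCongr (Equiv.refl _)
  have hs3 : Summable fun q : (Λ × Λ) × Config Λ => hopTerm h A ψ q.1.swap q.2 :=
    e.summable_iff.2 hs1
  have h2 : ∑' p, ∑' τ, hopTerm h A ψ p τ =
      ∑' q : (Λ × Λ) × Config Λ, hopTerm h A ψ q.1 q.2 := hs1.tsum_prod.symm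
  have h3 : ∑' q : (Λ × Λ) × Config Λ, hopTerm h A ψ q.1.swap q.2 =
      ∑' q : (Λ × Λ) × Config Λ, hopTerm h A ψ q.1 q.2 :=
    e.tsum_eq fun q : (Λ × Λ) × Config Λ => hopTerm h A ψ q.1 q.2
  have h4 : ∀ q : (Λ × Λ) × Config Λ, (hopTerm h A ψ q.1 q.2 + hopTerm h A ψ q.1.swap q.2).im =
      (A (q.2 + Finsupp.single q.1.1 1) - A (q.2 + Finsupp.single q.1.2 1)) *
        (offDiag h q.1.1 q.1.2 *
          (starRingEnd ℂ (annihilate q.1.1 ψ q.2) * annihilate q.1.2 ψ q.2)).im := by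
    intro q
    have h5 : (offDiag h q.1.2 q.1.1 *
          (starRingEnd ℂ (annihilate q.1.2 ψ q.2) * annihilate q.1.1 ψ q.2)) =
        starRingEnd ℂ (offDiag h q.1.1 q.1.2 *
          (starRingEnd ℂ (annihilate q.1.1 ψ q.2) * annihilate q.1.2 ψ q.2)) := by
      rw [offDiag_star hh]
      simp only [map_mul, Complex.conj_conj]
      ring
    simp only [hopTerm, Prod.fst_swap, Prod.snd_swap, h5]
    rw [Complex.add_im, Complex.im_ofReal_mul, Complex.im_ofReal_mul, Complex.conj_im]
    ring
  have h6 := Complex.hasSum_im (hs1.add hs3).hasSum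
  rw [hs1.tsum_add hs3, h3] at h6
  simp_rw [h4] at h6
  rw [h1, h2, ← h6.summable.tsum_prod, h6.tsum_eq, Complex.add_im]
  ring

/-- The bound on the commutator `i[H, A]` for an observable `A` that is diagonal in the occupation
number basis: only the hopping terms contribute, with the discrete gradient of `A`. -/
theorem current_le (hh : ∀ x y, h x y = star (h y x))
    (hK : ∀ x, ∑' y, ‖offDiag h x y‖ₑ ≤ K) {A : Config Λ → ℝ} {M : ℕ} {B : ℝ≥0}
    (hA : ∀ σ, ‖A σ‖ₑ ≤ B * cutoff M σ) {ψ φ : Fock Λ} (hφ : hamiltonian h v ψ = φ) :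
    ‖2 * ∑' σ, A σ * (starRingEnd ℂ (ψ σ) * φ σ).im‖ₑ ≤ ∑' p : Λ × Λ, ∑' τ,
      ‖A (τ + Finsupp.single p.1 1) - A (τ + Finsupp.single p.2 1)‖ₑ *
        (‖offDiag h p.1 p.2‖ₑ * (‖annihilate p.1 ψ τ‖ₑ * ‖annihilate p.2 ψ τ‖ₑ)) := by
  have h1 : ∀ σ, A σ * (starRingEnd ℂ (ψ σ) * φ σ).im = (∑' p, siteTerm h A ψ p σ).im := by
    intro σ
    have h2 : φ σ = hamiltonian h v ψ σ := by rw [hφ]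
    simp only [siteTerm]
    rw [h2, hamiltonian_eq hh v hK, tsum_mul_left, tsum_mul_left, Complex.im_ofReal_mul, mul_add,
      Complex.add_im]
    -- The diagonal energy is real, so it contributes nothing to the imaginary part, whatever the
    -- size of `v`.
    have h3 : starRingEnd ℂ (ψ σ) * (diagEnergy h v σ * ψ σ) =
        ((diagEnergy h v σ * Complex.normSq (ψ σ) : ℝ) : ℂ) := by
      rw [mul_left_comm, mul_comm (starRingEnd ℂ (ψ σ)), Complex.mul_conj]
      push_cast
      rfl
    rw [h3, Complex.ofReal_im, add_zero]
  have hs : Summable fun σ => ∑' p, siteTerm h A ψ p σ := by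
    have hs2 : Summable fun q : Config Λ × (Λ × Λ) => siteTerm h A ψ q.2 q.1 := by
      refine Summable.of_enorm ?_
      rw [ENNReal.tsum_prod', ENNReal.tsum_comm]
      convert (tsum_enorm_hopTerm_lt_top hh hK hA ψ).ne using 3 with p
      rw [← tsum_add_single p.1 fun σ hσ => by simp [siteTerm_eq_zero A ψ p hσ]]
      simp_rw [siteTerm_add_single]
    exact hs2.prod
  simp_rw [h1]
  rw [← Complex.im_tsum hs, two_mul_im_tsum_siteTerm hh hK hA]
  refine enorm_tsum_le_tsum_enorm.trans (ENNReal.tsum_le_tsum fun p => ?_)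
  refine enorm_tsum_le_tsum_enorm.trans (ENNReal.tsum_le_tsum fun τ => ?_)
  rw [enorm_mul]
  gcongr
  have h2 : ‖annihilate p.1 ψ τ‖ₑ = ‖starRingEnd ℂ (annihilate p.1 ψ τ)‖ₑ := by
    rw [← ofReal_norm, ← ofReal_norm, RCLike.norm_conj]
  rw [h2, ← enorm_mul, ← enorm_mul, ← ofReal_norm, ← ofReal_norm]
  exact ENNReal.ofReal_le_ofReal (Complex.abs_im_le_norm _)

/-- Hopping preserves the particle number, so the indicator of a sector has zero discrete gradient
and its current vanishes. Summing over the sectors gives the imaginary part of the inner product,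
with no domain condition beyond `Hψ` being square summable. -/
theorem maximalSymmetric_hamiltonianColumn (hh : ∀ x y, h x y = star (h y x))
    (hK : ∀ x, ∑' y, ‖offDiag h x y‖ₑ ≤ K) : MaximalSymmetric (hamiltonianColumn h v) := by
  intro ψ φ hψ
  have hφ : hamiltonian h v ψ = φ := by
    ext σ
    rw [← inner_hamiltonianColumn hh v hK, hψ]
  have h1 : HasSum (fun σ => (starRingEnd ℂ (ψ σ) * φ σ).im) (inner ℂ ψ φ).im := by
    have := Complex.hasSum_im (lp.hasSum_inner (𝕜 := ℂ) ψ φ)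
    simpa only [RCLike.inner_apply', ] using this
  have h2 := h1.tsum_fiberwise fun σ => σ.degree
  have h3 : ∀ N : ℕ, ∑' σ : (fun σ : Config Λ => σ.degree) ⁻¹' {N},
      (starRingEnd ℂ (ψ σ) * φ σ).im = 0 := by
    intro N
    let A : Config Λ → ℝ := fun σ => if σ.degree = N then 1 else 0
    have hA : ∀ σ, ‖A σ‖ₑ ≤ (1 : ℝ≥0) * cutoff N σ := by
      intro σ
      simp only [A, cutoff]
      split_ifs with ha hb hb
      · simp
      · exact absurd ha.le hb
      · simp
      · simp
    have h4 := current_le hh hK hA hφ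
    have h5 : ∀ (τ : Config Λ) (x y : Λ),
        A (τ + Finsupp.single x 1) - A (τ + Finsupp.single y 1) = 0 := by
      intro τ x y
      simp only [A, degree_add_single, sub_self]
    simp only [h5, enorm_zero, zero_mul, tsum_zero, nonpos_iff_eq_zero, enorm_eq_zero,
      mul_eq_zero, two_ne_zero, false_or] at h4
    rw [← h4]
    refine (tsum_subtype _ fun σ => (starRingEnd ℂ (ψ σ) * φ σ).im).trans (tsum_congr fun σ => ?_)
    by_cases hN : σ.degree = N
    · exact (indicator_of_mem (s := (fun σ : Config Λ => σ.degree) ⁻¹' {N}) hN _).trans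
        (by simp only [A, if_pos hN, one_mul])
    · exact (indicator_of_notMem (s := (fun σ : Config Λ => σ.degree) ⁻¹' {N}) hN _).trans
        (by simp only [A, if_neg hN, zero_mul])
  simp_rw [h3] at h2
  exact h2.unique hasSum_zero

theorem exists_isPropagator (hh : ∀ x y, h x y = star (h y x))
    (hK : ∀ x, ∑' y, ‖offDiag h x y‖ₑ ≤ K) : ∃ U, IsPropagator h v U := by
  obtain ⟨U, h1, h2, h3, h4, h5⟩ := exists_unitaryGroup
    (k := hamiltonianColumn h v) (fun σ τ => hamiltonianColumn_symm hh v hK σ τ)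
    (maximalSymmetric_hamiltonianColumn hh hK)
  refine ⟨U, h1, h2, h3, h4, fun ψ φ => ?_⟩
  rw [← h5 ψ φ, funext_iff]
  simp_rw [inner_hamiltonianColumn hh v hK]

end Current

/-! ### The front profile and the comparison of its increments with its slopes. -/

section Profile

/-- An increasing function with the power tail `|r|⁻ⁿ / n` at `-∞` and the limit `2 / n` at `∞`. -/
def profile (n : ℕ) (r : ℝ) : ℝ :=
  if r ≤ 0 then ((1 - r) ^ n)⁻¹ / n else 2 / n - ((1 + r) ^ n)⁻¹ / n

/-- The derivative of `profile n`. -/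
def slope (n : ℕ) (r : ℝ) : ℝ := ((1 + |r|) ^ (n + 1))⁻¹

lemma slope_pos (n : ℕ) (r : ℝ) : 0 < slope n r := by unfold slope; positivity

lemma slope_le_one (n : ℕ) (r : ℝ) : slope n r ≤ 1 :=
  inv_le_one_of_one_le₀ (one_le_pow₀ (by linarith [abs_nonneg r]))

lemma hasDerivAt_inv_pow_div {n : ℕ} (hn : 1 ≤ n) {z : ℝ} (hz : 0 < z) :
    HasDerivAt (fun z : ℝ => (z ^ n)⁻¹ / n) (-(z ^ (n + 1))⁻¹) z := by
  obtain ⟨m, rfl⟩ : ∃ m, n = m + 1 := ⟨n - 1, by omega⟩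
  have h := (((hasDerivAt_pow (m + 1) z).inv (by positivity)).div_const ((m + 1 : ℕ) : ℝ))
  refine h.congr_deriv ?_
  have : ((m + 1 : ℕ) : ℝ) ≠ 0 := by positivity
  simp only [Nat.add_sub_cancel]
  field_simp
  ring

lemma hasDerivAt_profile {n : ℕ} (hn : 1 ≤ n) (r : ℝ) :
    HasDerivAt (profile n) (slope n r) r := by
  have hleft : ∀ r ≤ 0, HasDerivAt (fun r : ℝ => ((1 - r) ^ n)⁻¹ / n) (slope n r) r := by
    intro r hr
    have h := (hasDerivAt_inv_pow_div hn (z := 1 - r) (by linarith)).comp r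
      ((hasDerivAt_id r).const_sub 1)
    refine h.congr_deriv ?_
    rw [slope, abs_of_nonpos hr]
    ring
  have hright : ∀ r ≥ 0, HasDerivAt (fun r : ℝ => 2 / n - ((1 + r) ^ n)⁻¹ / n) (slope n r) r := by
    intro r hr
    have h := ((hasDerivAt_inv_pow_div hn (z := 1 + r) (by linarith)).comp r
      ((hasDerivAt_id r).const_add 1)).const_sub (2 / (n : ℝ))
    refine h.congr_deriv ?_
    rw [slope, abs_of_nonneg hr]
    ring
  rcases lt_trichotomy r 0 with hr | hr | hr
  · refine (hleft r hr.le).congr_of_eventuallyEq ?_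
    filter_upwards [eventually_lt_nhds hr] with x hx
    rw [profile, if_pos hx.le]
  · subst hr
    have h1 : HasDerivWithinAt (profile n) (slope n 0) (Iic 0) 0 :=
      (hleft 0 le_rfl).hasDerivWithinAt.congr (fun x hx => if_pos hx) (if_pos le_rfl)
    have h2 : HasDerivWithinAt (profile n) (slope n 0) (Ici 0) 0 := by
      have hzero : profile n 0 = 2 / n - ((1 + 0) ^ n)⁻¹ / n := by
        rw [profile, if_pos le_rfl]; norm_num; ring
      refine (hright 0 le_rfl).hasDerivWithinAt.congr (fun x hx => ?_) hzero
      rcases (mem_Ici.1 hx).eq_or_lt with h | h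
      · rw [← h]; exact hzero
      · exact if_neg (not_le.2 h)
    have h3 := h1.union h2
    rwa [Iic_union_Ici, hasDerivWithinAt_univ] at h3
  · refine (hright r hr.le).congr_of_eventuallyEq ?_
    filter_upwards [eventually_gt_nhds hr] with x hx
    rw [profile, if_neg (not_le.2 hx)]

lemma profile_zero (n : ℕ) : profile n 0 = 1 / n := by simp [profile]

lemma profile_neg (n : ℕ) {r : ℝ} (hr : 0 ≤ r) : profile n (-r) = ((1 + r) ^ n)⁻¹ / n := by
  rw [profile, if_pos (by linarith), sub_neg_eq_add]

lemma profile_nonneg (n : ℕ) (r : ℝ) : 0 ≤ profile n r := by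
  unfold profile
  split_ifs with h
  · have : 0 ≤ 1 - r := by linarith
    positivity
  · rw [← sub_div]
    have h1 : ((1 + r) ^ n)⁻¹ ≤ 1 := inv_le_one_of_one_le₀ (one_le_pow₀ (by linarith))
    exact div_nonneg (by linarith) (Nat.cast_nonneg n)

lemma profile_le_two {n : ℕ} (hn : 1 ≤ n) (r : ℝ) : profile n r ≤ 2 := by
  have hn' : (1 : ℝ) ≤ n := by exact_mod_cast hn
  unfold profile
  split_ifs with h
  · have h1 : ((1 - r) ^ n)⁻¹ ≤ 1 := inv_le_one_of_one_le₀ (one_le_pow₀ (by linarith))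
    rw [div_le_iff₀ (by linarith)]
    linarith
  · have h1 : 0 ≤ ((1 + r) ^ n)⁻¹ / n := by
      have : 0 ≤ 1 + r := by linarith
      positivity
    have h2 : (2 : ℝ) / n ≤ 2 := div_le_self (by norm_num) hn'
    linarith

lemma monotone_profile {n : ℕ} (hn : 1 ≤ n) : Monotone (profile n) :=
  monotone_of_hasDerivAt_nonneg (hasDerivAt_profile hn) fun r => (slope_pos n r).le

lemma abs_slope_sub_le (n : ℕ) (r z : ℝ) : |slope n z - slope n r| ≤ (n + 1) * |z - r| := by
  have ha : 0 < 1 + |z| := by positivity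
  have hb : 0 < 1 + |r| := by positivity
  have ha1 : (1 + |z|)⁻¹ ≤ 1 := inv_le_one_of_one_le₀ (by linarith [abs_nonneg z])
  have hb1 : (1 + |r|)⁻¹ ≤ 1 := inv_le_one_of_one_le₀ (by linarith [abs_nonneg r])
  have h1 : |(1 + |z|)⁻¹ - (1 + |r|)⁻¹| ≤ |z - r| := by
    rw [inv_sub_inv ha.ne' hb.ne', abs_div, abs_of_pos (mul_pos ha hb)]
    refine (div_le_self (abs_nonneg _) ?_).trans ?_
    · nlinarith [abs_nonneg z, abs_nonneg r]
    · rw [add_sub_add_left_eq_sub, abs_sub_comm z r]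
      exact abs_abs_sub_abs_le _ _
  have h2 := abs_pow_sub_pow_le (1 + |z|)⁻¹ (1 + |r|)⁻¹ (n + 1)
  rw [slope, slope, ← inv_pow, ← inv_pow]
  refine h2.trans ?_
  have h3 : max |(1 + |z|)⁻¹| |(1 + |r|)⁻¹| ^ (n + 1 - 1) ≤ 1 := by
    refine pow_le_one₀ (le_max_of_le_left (abs_nonneg _)) (max_le ?_ ?_)
    · rwa [abs_of_pos (by positivity)]
    · rwa [abs_of_pos (by positivity)]
  calc _ ≤ |z - r| * ((n + 1 : ℕ) : ℝ) * 1 := by gcongr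
    _ = _ := by push_cast; ring

lemma abs_profile_sub_sub_le {n : ℕ} (hn : 1 ≤ n) (r t : ℝ) :
    |profile n (r + t) - profile n r - t * slope n r| ≤ (n + 1) * t ^ 2 := by
  have hder : ∀ z, HasDerivAt (fun z => profile n z - z * slope n r)
      (slope n z - slope n r) z := fun z =>
    ((hasDerivAt_profile hn z).sub ((hasDerivAt_id z).mul_const (slope n r))).congr_deriv
      (by rw [one_mul])
  have h := (convex_uIcc r (r + t)).norm_image_sub_le_of_norm_hasDerivWithin_le
    (C := (n + 1) * |t|) (fun z _ => (hder z).hasDerivWithinAt) (fun z hz => by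
      rw [Real.norm_eq_abs]
      refine (abs_slope_sub_le n r z).trans ?_
      have : |z - r| ≤ |t| := by simpa using abs_sub_left_of_mem_uIcc hz
      gcongr) left_mem_uIcc right_mem_uIcc
  rw [Real.norm_eq_abs, Real.norm_eq_abs, add_sub_cancel_left, mul_assoc, ← pow_two, sq_abs] at h
  refine le_trans (le_of_eq ?_) h
  congr 1
  ring

/-- Moving the argument by `D` changes `1 + |r|` by a factor of at most `1 + D`. -/
lemma slope_le_mul {n : ℕ} {r z D : ℝ} (hD : |r - z| ≤ D) :
    slope n z ≤ slope n r * (1 + D) ^ (n + 1) := by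
  have hD0 : 0 ≤ D := (abs_nonneg _).trans hD
  have h1 : |r| ≤ |z| + D := by linarith [abs_sub_abs_le_abs_sub r z]
  have h2 : (1 + |r|) ^ (n + 1) ≤ ((1 + |z|) * (1 + D)) ^ (n + 1) := by
    gcongr
    nlinarith [abs_nonneg z]
  rw [slope, slope, inv_mul_eq_div, inv_eq_one_div, div_le_div_iff₀ (by positivity) (by positivity)]
  rw [mul_pow] at h2
  linarith

lemma slope_le_of_abs_le {n : ℕ} {r z : ℝ} (h : |r| ≤ |z|) : slope n z ≤ slope n r := by
  unfold slope
  gcongr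

/-- The slope at the mean value point is compared once with each endpoint, which produces the
geometric mean. -/
lemma sq_profile_sub_le_of_lt {n : ℕ} (hn : 1 ≤ n) {r r' : ℝ} (h : r < r') :
    (profile n r' - profile n r) ^ 2 ≤
      ((r' - r) * (1 + (r' - r)) ^ (n + 1)) ^ 2 * (slope n r * slope n r') := by
  obtain ⟨z, hz, hz'⟩ := exists_hasDerivAt_eq_slope (profile n) (slope n) h
    (fun x _ => (hasDerivAt_profile hn x).continuousAt.continuousWithinAt)
    fun x _ => hasDerivAt_profile hn x
  have hpos : 0 < r' - r := by linarith
  rw [eq_div_iff hpos.ne'] at hz'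
  have h1 : slope n z ≤ slope n r * (1 + (r' - r)) ^ (n + 1) :=
    slope_le_mul (by rw [abs_le]; constructor <;> linarith [hz.1, hz.2])
  have h2 : slope n z ≤ slope n r' * (1 + (r' - r)) ^ (n + 1) :=
    slope_le_mul (by rw [abs_le]; constructor <;> linarith [hz.1, hz.2])
  rw [← hz']
  calc (slope n z * (r' - r)) ^ 2 = (r' - r) ^ 2 * (slope n z * slope n z) := by ring
    _ ≤ (r' - r) ^ 2 * ((slope n r * (1 + (r' - r)) ^ (n + 1)) *
        (slope n r' * (1 + (r' - r)) ^ (n + 1))) := by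
        have := slope_pos n z
        have := slope_pos n r
        gcongr
    _ = _ := by ring

/-- For distant points the bound `sq_profile_sub_le_of_lt` would cost `D^(n + 2)`, one power more
than the moment `κ_n` controls. The shape of the profile saves that power. -/
lemma sq_profile_sub_le_of_one_le {n : ℕ} (hn : 1 ≤ n) {r r' : ℝ} (h : 1 ≤ r' - r) :
    (profile n r' - profile n r) ^ 2 ≤
      (2 ^ (n + 2) * (r' - r) ^ (n + 1)) ^ 2 * (slope n r * slope n r') := by
  set D := r' - r with hD
  have hg := slope_pos n r
  have hg' := slope_pos n r'
  have h1D : (1 + D) ^ (n + 1) ≤ 2 ^ (n + 1) * D ^ (n + 1) := by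
    rw [← mul_pow]
    gcongr
    linarith
  -- On one side of the origin the slope at the mean value point is at most that of the endpoint
  -- nearer to `0`, without loss. Only one factor `(1 + D)^(n + 1)` remains, and `n + 3 ≤ 2 (n +
  -- 1)`.
  by_cases hsign : 0 ≤ r ∨ r' ≤ 0
  · obtain ⟨z, hz, hz'⟩ := exists_hasDerivAt_eq_slope (profile n) (slope n)
      (show r < r' by linarith)
      (fun x _ => (hasDerivAt_profile hn x).continuousAt.continuousWithinAt)
      fun x _ => hasDerivAt_profile hn x
    rw [eq_div_iff (by linarith), ← hD] at hz'
    have hz2 : slope n z * slope n z ≤ slope n r * slope n r' * (1 + D) ^ (n + 1) := by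
      have hzpos := slope_pos n z
      rcases hsign with h0 | h0
      · have h2 : slope n z ≤ slope n r := slope_le_of_abs_le (by
          rw [abs_of_nonneg h0, abs_of_nonneg (h0.trans hz.1.le)]; exact hz.1.le)
        have h3 : slope n z ≤ slope n r' * (1 + D) ^ (n + 1) :=
          slope_le_mul (by rw [abs_le]; constructor <;> linarith [hz.1, hz.2])
        calc _ ≤ slope n r * (slope n r' * (1 + D) ^ (n + 1)) := by gcongr
          _ = _ := by ring
      · have h2 : slope n z ≤ slope n r' := slope_le_of_abs_le (by
          rw [abs_of_nonpos h0, abs_of_nonpos (hz.2.le.trans h0)]; linarith [hz.2])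
        have h3 : slope n z ≤ slope n r * (1 + D) ^ (n + 1) :=
          slope_le_mul (by rw [abs_le]; constructor <;> linarith [hz.1, hz.2])
        calc _ ≤ slope n r' * (slope n r * (1 + D) ^ (n + 1)) := by gcongr
          _ = _ := by ring
    rw [← hz']
    calc (slope n z * D) ^ 2 = D ^ 2 * (slope n z * slope n z) := by ring
      _ ≤ D ^ 2 * (slope n r * slope n r' * (2 ^ (n + 1) * D ^ (n + 1))) := by
          exact mul_le_mul_of_nonneg_left (hz2.trans (by gcongr)) (sq_nonneg D)
      _ = (2 ^ (n + 1) * D ^ (n + 3)) * (slope n r * slope n r') := by ring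
      _ ≤ (2 ^ (n + 2) * D ^ (n + 1)) ^ 2 * (slope n r * slope n r') := by
          gcongr
          rw [mul_pow, ← pow_mul, ← pow_mul]
          gcongr
          · norm_num
          · omega
          · omega
  -- Across the origin `|r| + |r'| = D`, so the product of the slopes is at least `(1 + D)^(-2 (n +
  -- 1))`, while the increment is at most `2`; that `2` turns `2^(n + 1)` into `2^(n + 2)`.
  · push Not at hsign
    have h2 : (profile n r' - profile n r) ^ 2 ≤ 2 ^ 2 := by
      have h3 := profile_nonneg n r
      have h4 := profile_le_two hn r'
      have h5 := monotone_profile hn (show r ≤ r' by linarith)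
      exact pow_le_pow_left₀ (by linarith) (by linarith) 2
    have h3 : 1 ≤ slope n r * slope n r' * ((1 + D) ^ (n + 1)) ^ 2 := by
      rw [slope, slope, ← mul_inv, ← mul_pow, inv_mul_eq_div, one_le_div (by positivity), ← pow_mul,
        mul_comm (n + 1) 2, pow_mul, abs_of_neg hsign.1, abs_of_pos hsign.2]
      refine pow_le_pow_left₀ (by nlinarith) ?_ _
      nlinarith
    calc _ ≤ 2 ^ 2 * (slope n r * slope n r' * ((1 + D) ^ (n + 1)) ^ 2) := by linarith
      _ ≤ 2 ^ 2 * (slope n r * slope n r' * (2 ^ (n + 1) * D ^ (n + 1)) ^ 2) := by gcongr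
      _ = _ := by ring

/-- Increments up to `δ` are nearly linear with constant `(1 + δ)^(n + 1)`. Between `δ` and `1` the
inequality `D ≤ δ⁻ⁿ D^(n + 1)` moves everything into the higher power, and beyond `1` the estimate
for distant points applies. -/
lemma sq_profile_sub_le {n : ℕ} (hn : 1 ≤ n) {δ : ℝ} (hδ : 0 < δ) (hδ1 : δ ≤ 1) (r r' : ℝ) :
    (profile n r' - profile n r) ^ 2 ≤
      ((1 + δ) ^ (n + 1) * |r' - r| + 2 ^ (n + 2) * (δ ^ n)⁻¹ * |r' - r| ^ (n + 1)) ^ 2 *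
        (slope n r * slope n r') := by
  wlog hlt : r ≤ r' generalizing r r'
  · have := this r' r (by linarith)
    rw [abs_sub_comm, mul_comm (slope n r), ← neg_sub, neg_sq]
    exact this
  rw [abs_of_nonneg (by linarith)]
  rcases hlt.eq_or_lt with rfl | hlt
  · simp
  set D := r' - r with hD
  have hD0 : 0 < D := by linarith
  have hg := slope_pos n r
  have hg' := slope_pos n r'
  have hδn : 1 ≤ (δ ^ n)⁻¹ := (one_le_inv₀ (by positivity)).2 (pow_le_one₀ hδ.le hδ1)
  rcases le_total D δ with h | h
  · refine (sq_profile_sub_le_of_lt hn hlt).trans ?_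
    rw [← hD]
    gcongr
    calc D * (1 + D) ^ (n + 1) ≤ D * (1 + δ) ^ (n + 1) := by gcongr
      _ = (1 + δ) ^ (n + 1) * D := mul_comm _ _
      _ ≤ _ := le_add_of_nonneg_right (by positivity)
  rcases le_total D 1 with h' | h'
  · refine (sq_profile_sub_le_of_lt hn hlt).trans ?_
    rw [← hD]
    gcongr
    calc D * (1 + D) ^ (n + 1) ≤ D * 2 ^ (n + 2) := by
          gcongr
          calc (1 + D) ^ (n + 1) ≤ 2 ^ (n + 1) := by gcongr; linarith
            _ ≤ 2 ^ (n + 2) := by gcongr <;> norm_num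
      _ = 2 ^ (n + 2) * (δ ^ n)⁻¹ * (δ ^ n * D) := by field_simp
      _ ≤ 2 ^ (n + 2) * (δ ^ n)⁻¹ * (D ^ n * D) := by gcongr
      _ = 2 ^ (n + 2) * (δ ^ n)⁻¹ * D ^ (n + 1) := by rw [pow_succ D n]
      _ ≤ _ := le_add_of_nonneg_left (by positivity)
  · refine (sq_profile_sub_le_of_one_le hn h').trans ?_
    rw [← hD]
    gcongr
    calc 2 ^ (n + 2) * D ^ (n + 1) ≤ 2 ^ (n + 2) * (δ ^ n)⁻¹ * D ^ (n + 1) := by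
          gcongr
          exact le_mul_of_one_le_right (by positivity) hδn
      _ ≤ _ := le_add_of_nonneg_left (by positivity)

/-- After rescaling by a large constant `s`, the differences of the profile are dominated by the
geometric mean of its slopes, with a linear constant as close to `1` as needed. -/
theorem exists_profile_scale {n : ℕ} (hn : 1 ≤ n) {κ κn c : ℝ} (hκn : 0 ≤ κn)
    (hc : κ < c) :
    ∃ s a b : ℝ, 0 < s ∧ 0 ≤ a ∧ 0 ≤ b ∧ a * κ + b * κn ≤ c ∧
      ∀ u w : ℝ, (profile n (u / s) - profile n (w / s)) ^ 2 ≤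
        ((a * |u - w| + b * |u - w| ^ (n + 1)) / s) ^ 2 *
          (slope n (u / s) * slope n (w / s)) := by
  -- Half of the gap `c - κ` is spent on the linear constant.
  obtain ⟨δ, hδ, hδ1, hδκ⟩ : ∃ δ : ℝ, 0 < δ ∧ δ ≤ 1 ∧ (1 + δ) ^ (n + 1) * κ < (κ + c) / 2 := by
    have h1 : Tendsto (fun δ : ℝ => (1 + δ) ^ (n + 1) * κ) (𝓝[>] 0) (𝓝 ((1 + 0) ^ (n + 1) * κ)) :=
      ((by fun_prop : Continuous fun δ : ℝ => (1 + δ) ^ (n + 1) * κ).tendsto 0).mono_left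
        nhdsWithin_le_nhds
    have h2 := h1.eventually (gt_mem_nhds (show (1 + 0) ^ (n + 1) * κ < (κ + c) / 2 by
      rw [add_zero, one_pow]; linarith))
    obtain ⟨δ, hδ, hδ'⟩ := (h2.and (Ioc_mem_nhdsGT one_pos)).exists
    exact ⟨δ, hδ'.1, hδ'.2, hδ⟩
  set B : ℝ := 2 ^ (n + 2) * (δ ^ n)⁻¹ with hB
  have hB0 : 0 ≤ B := by positivity
  have hcκ : 0 < c - κ := by linarith
  -- The other half pays for the higher moment, whose coefficient carries `s⁻ⁿ` after rescaling.
  set s : ℝ := 1 + 2 * (B * κn) / (c - κ) with hs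
  have hs1 : 1 ≤ s := by
    have : 0 ≤ 2 * (B * κn) / (c - κ) := by positivity
    linarith
  have hs0 : 0 < s := by linarith
  refine ⟨s, (1 + δ) ^ (n + 1), B * (s ^ n)⁻¹, hs0, by positivity, by positivity, ?_, ?_⟩
  · have h1 : B * (s ^ n)⁻¹ * κn ≤ (c - κ) / 2 := by
      have h2 : s ≤ s ^ n := le_self_pow₀ hs1 (by omega)
      rw [mul_right_comm, ← div_eq_mul_inv, div_le_iff₀ (by positivity)]
      have h3 : B * κn ≤ (c - κ) / 2 * s := by
        rw [hs]
        have : (c - κ) / 2 * (1 + 2 * (B * κn) / (c - κ)) = (c - κ) / 2 + B * κn := by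
          field_simp
        linarith
      exact h3.trans (by gcongr)
    linarith
  · intro u w
    have h := sq_profile_sub_le hn hδ hδ1 (w / s) (u / s)
    rw [← sub_div, abs_div, abs_of_pos hs0, mul_comm (slope n (w / s))] at h
    convert h using 3
    rw [div_pow, ← hB, pow_succ s]
    field_simp

end Profile

/-! ### Quadratic forms of bounded diagonal observables and their time derivatives. -/

section DiagonalForm

variable {I : Type*}

/-- The quadratic form `∑ aᵢ |fᵢ|²` of a diagonal observable. -/
def diagForm (a : I → ℝ) (f : EllTwo I) : ℝ := ∑' i, a i * ‖f i‖ ^ 2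

/-- Multiplication by a bounded real family. -/
def diagOp (a : I → ℝ) {C : ℝ} (ha : ∀ i, |a i| ≤ C) : EllTwo I →L[ℂ] EllTwo I :=
  LinearMap.mkContinuous
    { toFun := fun f => ⟨fun i => (a i : ℂ) * f i, by
        refine memℓp_gen ?_
        have h := (lp.hasSum_norm (p := 2) (by norm_num) f).summable.mul_left (C ^ 2)
        simp only [ENNReal.toReal_ofNat, Real.rpow_ofNat] at h ⊢
        refine h.of_nonneg_of_le (fun i => by positivity) fun i => ?_
        rw [norm_mul, mul_pow, Complex.norm_real, Real.norm_eq_abs]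
        gcongr
        exact ha i⟩
      map_add' := fun f g => by
        ext i
        exact mul_add _ _ _
      map_smul' := fun c f => by
        ext i
        exact mul_left_comm _ _ _ } C fun f => by
    by_cases hI : Nonempty I
    · have hC : 0 ≤ C := (abs_nonneg _).trans (ha hI.some)
      refine lp.norm_le_of_forall_sum_le (by norm_num) (by positivity) fun s => ?_
      have h := lp.sum_rpow_le_norm_rpow (p := 2) (by norm_num) f s
      simp only [ENNReal.toReal_ofNat, Real.rpow_ofNat] at h ⊢
      calc _ ≤ ∑ i ∈ s, C ^ 2 * ‖f i‖ ^ 2 := by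
            refine Finset.sum_le_sum fun i _ => ?_
            change ‖(a i : ℂ) * f i‖ ^ 2 ≤ _
            rw [norm_mul, mul_pow, Complex.norm_real, Real.norm_eq_abs]
            gcongr
            exact ha i
        _ ≤ _ := by
            rw [← Finset.mul_sum, mul_pow]
            gcongr
    · have hz : ∀ g : EllTwo I, ‖g‖ = 0 := fun g => by
        rw [norm_eq_zero]
        ext i
        exact absurd ⟨i⟩ hI
      rw [hz, hz f, mul_zero]

lemma diagOp_apply (a : I → ℝ) {C : ℝ} (ha : ∀ i, |a i| ≤ C) (f : EllTwo I) (i : I) :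
    diagOp a ha f i = a i * f i := rfl

lemma hasSum_inner_diagOp (a : I → ℝ) {C : ℝ} (ha : ∀ i, |a i| ≤ C) (f g : EllTwo I) :
    HasSum (fun i => a i * (starRingEnd ℂ (f i) * g i).re) (inner ℂ f (diagOp a ha g)).re := by
  have h := Complex.hasSum_re (lp.hasSum_inner (𝕜 := ℂ) f (diagOp a ha g))
  refine h.congr_fun fun i => ?_
  rw [diagOp_apply, RCLike.inner_apply', mul_left_comm, Complex.re_ofReal_mul]

lemma hasSum_diagForm (a : I → ℝ) {C : ℝ} (ha : ∀ i, |a i| ≤ C) (f : EllTwo I) :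
    HasSum (fun i => a i * ‖f i‖ ^ 2) (inner ℂ f (diagOp a ha f)).re := by
  refine (hasSum_inner_diagOp a ha f f).congr_fun fun i => ?_
  rw [Complex.conj_mul', ← Complex.ofReal_pow, Complex.ofReal_re]

lemma diagForm_eq (a : I → ℝ) {C : ℝ} (ha : ∀ i, |a i| ≤ C) (f : EllTwo I) :
    diagForm a f = (inner ℂ f (diagOp a ha f)).re := (hasSum_diagForm a ha f).tsum_eq

lemma continuous_diagForm (a : I → ℝ) {C : ℝ} (ha : ∀ i, |a i| ≤ C) :
    Continuous (diagForm a) := by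
  have : diagForm a = fun f => (inner ℂ f (diagOp a ha f)).re := funext (diagForm_eq a ha)
  rw [this]
  exact Complex.continuous_re.comp (continuous_id.inner (diagOp a ha).continuous)

lemma summable_norm_sq (f : EllTwo I) : Summable fun i => ‖f i‖ ^ 2 := by
  have h := (lp.hasSum_norm (p := 2) (by norm_num) f).summable
  simpa only [ENNReal.toReal_ofNat, Real.rpow_ofNat] using h

lemma tsum_norm_sq (f : EllTwo I) : ∑' i, ‖f i‖ ^ 2 = ‖f‖ ^ 2 := by
  have h := (lp.hasSum_norm (p := 2) (by norm_num) f).tsum_eq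
  simpa only [ENNReal.toReal_ofNat, Real.rpow_ofNat] using h

lemma abs_diagForm_le (a : I → ℝ) {C : ℝ} (ha : ∀ i, |a i| ≤ C) (f : EllTwo I) :
    |diagForm a f| ≤ C * ‖f‖ ^ 2 := by
  rw [← tsum_norm_sq, ← tsum_mul_left, ← Real.norm_eq_abs, diagForm]
  refine tsum_of_norm_bounded ((summable_norm_sq f).mul_left C).hasSum fun i => ?_
  rw [norm_mul, Real.norm_eq_abs, Real.norm_of_nonneg (by positivity)]
  gcongr
  exact ha i

lemma hasDerivAt_diagForm_const (a : I → ℝ) {C : ℝ} (ha : ∀ i, |a i| ≤ C) {y : ℝ → EllTwo I}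
    {y' : EllTwo I} {t : ℝ} (hy : HasDerivAt y y' t) :
    HasDerivAt (fun t => diagForm a (y t))
      (2 * ∑' i, a i * (starRingEnd ℂ (y t i) * y' i).re) t := by
  have h1 : HasDerivAt (fun t => diagOp a ha (y t)) (diagOp a ha y') t :=
    ((diagOp a ha).restrictScalars ℝ).hasFDerivAt.comp_hasDerivAt t hy
  have h2 := Complex.reCLM.hasFDerivAt.comp_hasDerivAt t (hy.inner ℂ h1)
  have h3 := (hasSum_inner_diagOp a ha (y t) y').tsum_eq
  have h4 : (inner ℂ y' (diagOp a ha (y t))).re = (inner ℂ (y t) (diagOp a ha y')).re := by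
    refine (hasSum_inner_diagOp a ha y' (y t)).unique
      ((hasSum_inner_diagOp a ha (y t) y').congr_fun fun i => ?_)
    simp only [Complex.mul_re, Complex.conj_re, Complex.conj_im]
    ring
  refine (h2.congr_deriv ?_).congr_of_eventuallyEq
    (Eventually.of_forall fun s => diagForm_eq a ha (y s))
  rw [h3]
  simp only [Complex.reCLM_apply, Complex.add_re, h4]
  ring

/-- The family is split as `A s = A t + (s - t) A' + R s`. The remainder is quadratic uniformly in
the index, so the sum over indices needs no exchange of limits. -/
lemma hasDerivAt_diagForm {A : ℝ → I → ℝ} {A' : I → ℝ} {C : ℝ} {t : ℝ}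
    (hA : ∀ t i, |A t i| ≤ C) (hA' : ∀ i, |A' i| ≤ C)
    (hder : ∀ r i, |A (t + r) i - A t i - r * A' i| ≤ C * r ^ 2)
    {y : ℝ → EllTwo I} {y' : EllTwo I} (hy : HasDerivAt y y' t) :
    HasDerivAt (fun t => diagForm (A t) (y t))
      (diagForm A' (y t) + 2 * ∑' i, A t i * (starRingEnd ℂ (y t i) * y' i).re) t := by
  have h1 := hasDerivAt_diagForm_const (A t) (hA t) hy
  have h2 : HasDerivAt (fun s => (s - t) * diagForm A' (y s)) (diagForm A' (y t)) t := by
    have := ((hasDerivAt_id t).sub_const t).mul (hasDerivAt_diagForm_const A' hA' hy)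
    exact this.congr_deriv (by simp)
  let R : ℝ → I → ℝ := fun s i => A s i - A t i - (s - t) * A' i
  have hR : ∀ s i, |R s i| ≤ C * (s - t) ^ 2 := by
    intro s i
    have := hder (s - t) i
    rwa [add_sub_cancel] at this
  have h3 : HasDerivAt (fun s => diagForm (R s) (y s)) 0 t := by
    rw [hasDerivAt_iff_isLittleO]
    have hRt : diagForm (R t) (y t) = 0 := by
      have := abs_diagForm_le (R t) (hR t) (y t)
      rw [sub_self, zero_pow two_ne_zero, mul_zero, zero_mul] at this
      exact abs_nonpos_iff.1 this
    simp only [hRt, sub_zero, smul_zero]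
    have h4 : (fun s => diagForm (R s) (y s)) =O[𝓝 t] fun s => (s - t) ^ 2 := by
      have h5 : ∀ᶠ s in 𝓝 t, ‖y s‖ ^ 2 ≤ ‖y t‖ ^ 2 + 1 :=
        (hy.continuousAt.norm.pow 2).eventually (eventually_le_nhds (lt_add_one _))
      refine Asymptotics.IsBigO.of_bound (|C| * (‖y t‖ ^ 2 + 1)) ?_
      filter_upwards [h5] with s hs
      rw [Real.norm_eq_abs, Real.norm_of_nonneg (sq_nonneg _)]
      calc _ ≤ _ := abs_diagForm_le (R s) (hR s) (y s)
        _ ≤ |C| * (s - t) ^ 2 * (‖y t‖ ^ 2 + 1) := by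
          gcongr
          exact le_abs_self C
        _ = _ := by ring
    have h6 : (fun s => (s - t) ^ 2) =o[𝓝 t] fun s => s - t := by
      simpa using (Asymptotics.isLittleO_pow_sub_sub t (m := 2) (by norm_num))
    exact h4.trans_isLittleO h6
  refine (((h1.add h2).add h3).congr_deriv (by ring)).congr_of_eventuallyEq
    (Eventually.of_forall fun s => ?_)
  have e1 := (hasSum_diagForm (A t) (hA t) (y s)).summable
  have e2 := (hasSum_diagForm A' hA' (y s)).summable.mul_left (s - t)
  have e3 := (hasSum_diagForm (R s) (hR s) (y s)).summable
  simp only [Pi.add_apply, diagForm]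
  rw [← tsum_mul_left, ← e1.tsum_add e2, ← (e1.add e2).tsum_add e3]
  refine tsum_congr fun i => ?_
  simp only [R]
  ring

end DiagonalForm

/-! ### Second quantization of functions on the lattice, with a particle number cutoff. -/

section SiteSum

variable {d : ℕ} {Λ : Set (EuclideanSpace ℝ (Fin d))}

/-- The eigenvalue `∑ₓ f(x) σₓ` of the second quantization of the function `f`. -/
def siteSum (f : Λ → ℝ) (σ : Config Λ) : ℝ := σ.sum fun x m => f x * m

lemma siteSum_add_single (f : Λ → ℝ) (τ : Config Λ) (x : Λ) :
    siteSum f (τ + Finsupp.single x 1) = siteSum f τ + f x := by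
  classical
  rw [siteSum, Finsupp.sum_add_index', Finsupp.sum_single_index]
  · simp [siteSum]
  · simp
  · simp
  · intro x m m'
    push_cast
    ring

lemma abs_siteSum_le {f : Λ → ℝ} {C : ℝ} (hf : ∀ x, |f x| ≤ C) (σ : Config Λ) :
    |siteSum f σ| ≤ C * σ.degree := by
  rw [siteSum, Finsupp.sum, Finsupp.degree_apply]
  push_cast
  rw [Finset.mul_sum]
  refine (Finset.abs_sum_le_sum_abs _ _).trans (Finset.sum_le_sum fun x _ => ?_)
  rw [abs_mul, Nat.abs_cast]
  gcongr
  exact hf x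

lemma ofReal_siteSum {f : Λ → ℝ} (hf : ∀ x, 0 ≤ f x) (σ : Config Λ) :
    ENNReal.ofReal (siteSum f σ) = ∑' x, ENNReal.ofReal (f x) * (σ x : ℕ) := by
  rw [siteSum, Finsupp.sum, ENNReal.ofReal_sum_of_nonneg, tsum_eq_sum (s := σ.support)]
  · refine Finset.sum_congr rfl fun x _ => ?_
    rw [ENNReal.ofReal_mul (hf x), ENNReal.ofReal_natCast]
  · intro x hx
    simp [Finsupp.notMem_support_iff.1 hx]
  · intro x _
    have := hf x
    positivity

/-- The second quantization of `f`, restricted to at most `M` particles. -/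
def cutSum (M : ℕ) (f : Λ → ℝ) (σ : Config Λ) : ℝ := cutoff M σ * siteSum f σ

lemma cutoff_le_one (M : ℕ) (σ : Config Λ) : cutoff M σ ≤ 1 := by
  unfold cutoff
  split_ifs <;> simp

lemma abs_cutSum_le {f : Λ → ℝ} {C : ℝ} (hC : 0 ≤ C) (hf : ∀ x, |f x| ≤ C) (M : ℕ)
    (σ : Config Λ) : |cutSum M f σ| ≤ C * M * cutoff M σ := by
  rw [cutSum, abs_mul, mul_comm, abs_of_nonneg (NNReal.coe_nonneg _)]
  unfold cutoff
  split_ifs with h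
  · have h1 := abs_siteSum_le hf σ
    have h2 : (σ.degree : ℝ) ≤ M := by exact_mod_cast h
    simp only [NNReal.coe_one, mul_one]
    exact h1.trans (by gcongr)
  · simp

lemma abs_cutSum_le' {f : Λ → ℝ} {C : ℝ} (hC : 0 ≤ C) (hf : ∀ x, |f x| ≤ C) (M : ℕ)
    (σ : Config Λ) : |cutSum M f σ| ≤ C * M :=
  (abs_cutSum_le hC hf M σ).trans (mul_le_of_le_one_right (by positivity)
    (by exact_mod_cast cutoff_le_one M σ))

/-- Both configurations have the same number of particles, so the cutoff factors out and only the
difference of the one-particle weights remains. -/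
lemma cutSum_add_single_sub (M : ℕ) (f : Λ → ℝ) (τ : Config Λ) (x y : Λ) :
    cutSum M f (τ + Finsupp.single x 1) - cutSum M f (τ + Finsupp.single y 1) =
      cutoff M (τ + Finsupp.single x 1) * (f x - f y) := by
  rw [cutSum, cutSum, cutoff_add_single M τ y x, siteSum_add_single, siteSum_add_single]
  ring

lemma cutSum_linear (M : ℕ) (f g k : Λ → ℝ) (r : ℝ) (σ : Config Λ) :
    cutSum M f σ - cutSum M g σ - r * cutSum M k σ =
      cutSum M (fun x => f x - g x - r * k x) σ := by
  simp only [cutSum, siteSum, Finsupp.sum, sub_mul, Finset.sum_sub_distrib, mul_assoc,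
    ← Finset.mul_sum]
  ring

lemma cutSum_nonneg (M : ℕ) {f : Λ → ℝ} (hf : ∀ x, 0 ≤ f x) (σ : Config Λ) :
    0 ≤ cutSum M f σ :=
  mul_nonneg (NNReal.coe_nonneg _) (Finset.sum_nonneg fun x _ => mul_nonneg (hf x) (by positivity))

lemma ofReal_diagForm_cutSum {f : Λ → ℝ} {C : ℝ} (hf : ∀ x, 0 ≤ f x) (hf' : ∀ x, f x ≤ C)
    (M : ℕ) (ψ : Fock Λ) :
    ENNReal.ofReal (diagForm (cutSum M f) ψ) =
      ∑' σ, (∑' x, (ENNReal.ofReal (f x) * cutoff M σ) * (σ x : ℕ)) * ‖ψ σ‖ₑ ^ 2 := by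
  have hC : ∀ x, |f x| ≤ |C| := fun x => by
    rw [abs_of_nonneg (hf x)]; exact (hf' x).trans (le_abs_self C)
  have hnn := cutSum_nonneg M hf
  rw [diagForm, ENNReal.ofReal_tsum_of_nonneg (fun σ => mul_nonneg (hnn σ) (by positivity))
    (hasSum_diagForm _ (abs_cutSum_le' (abs_nonneg C) hC M) ψ).summable]
  refine tsum_congr fun σ => ?_
  rw [ENNReal.ofReal_mul (hnn σ), cutSum, ENNReal.ofReal_mul (NNReal.coe_nonneg _),
    ofReal_siteSum hf, ENNReal.ofReal_coe_nnreal, ← ENNReal.tsum_mul_left,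
    ENNReal.ofReal_pow (norm_nonneg _), ofReal_norm]
  congr 1
  refine tsum_congr fun x => ?_
  ring

end SiteSum

/-! ### Monotonicity of the weighted particle number along a moving front. -/

section Velocity

variable {d : ℕ} {Λ : Set (EuclideanSpace ℝ (Fin d))}
variable {h : Λ → Λ → ℂ} {v : Λ → Λ → ℝ} {K : ℝ≥0}

lemma two_mul_abs_mul_le {D m g g' a b : ℝ} (hm : 0 ≤ m) (hg : 0 ≤ g) (hg' : 0 ≤ g') (ha : 0 ≤ a)
    (hb : 0 ≤ b) (hD : D ^ 2 ≤ m ^ 2 * (g * g')) :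
    2 * (|D| * (a * b)) ≤ m * (g * a ^ 2 + g' * b ^ 2) := by
  have h1 : |D| ≤ m * (Real.sqrt g * Real.sqrt g') := by
    refine abs_le_of_sq_le_sq (hD.trans (le_of_eq ?_)) (by positivity)
    rw [mul_pow, mul_pow, Real.sq_sqrt hg, Real.sq_sqrt hg']
  calc 2 * (|D| * (a * b)) ≤ 2 * (m * (Real.sqrt g * Real.sqrt g') * (a * b)) := by gcongr
    _ = m * (2 * (Real.sqrt g * a) * (Real.sqrt g' * b)) := by ring
    _ ≤ m * ((Real.sqrt g * a) ^ 2 + (Real.sqrt g' * b) ^ 2) := by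
        gcongr
        exact two_mul_le_add_sq _ _
    _ = _ := by rw [mul_pow, mul_pow, Real.sq_sqrt hg, Real.sq_sqrt hg']

/-- The increment of `f` is a geometric mean of values of `g`, which distributes over `‖a_x ψ‖ ‖a_y
ψ‖` by `2ab ≤ a² + b²`. The Schur test then returns the second quantization of `g`. -/
theorem current_cutSum_le (hh : ∀ x y, h x y = star (h y x))
    (hK : ∀ x, ∑' y, ‖offDiag h x y‖ₑ ≤ K) {f g : Λ → ℝ} {C : ℝ} (hC : 0 ≤ C)
    (hf : ∀ x, |f x| ≤ C) (hg : ∀ x, 0 ≤ g x) {m : Λ → Λ → ℝ} (hm : ∀ x y, 0 ≤ m x y)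
    (hm' : ∀ x y, m x y = m y x) (hfg : ∀ x y, (f x - f y) ^ 2 ≤ m x y ^ 2 * (g x * g y))
    {L : ℝ≥0∞} (hL : ∀ x, ∑' y, ‖offDiag h x y‖ₑ * ENNReal.ofReal (m x y) ≤ L) (M : ℕ)
    {ψ φ : Fock Λ} (hφ : hamiltonian h v ψ = φ) :
    ‖2 * ∑' σ, cutSum M f σ * (starRingEnd ℂ (ψ σ) * φ σ).im‖ₑ ≤
      L * ∑' σ, (∑' x, (ENNReal.ofReal (g x) * cutoff M σ) * (σ x : ℕ)) * ‖ψ σ‖ₑ ^ 2 := by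
  have hA : ∀ σ, ‖cutSum M f σ‖ₑ ≤ ((C * M).toNNReal : ℝ≥0) * cutoff M σ := by
    intro σ
    rw [← ofReal_norm, Real.norm_eq_abs]
    refine (ENNReal.ofReal_le_ofReal (abs_cutSum_le hC hf M σ)).trans (le_of_eq ?_)
    rw [ENNReal.ofReal_mul (by positivity), ENNReal.ofReal_coe_nnreal]
    rfl
  refine (current_le hh hK hA hφ).trans ?_
  let u : Λ → ℝ≥0∞ := fun x => ∑' τ, (ENNReal.ofReal (g x) * cutoff M (τ + Finsupp.single x 1)) *
    ‖annihilate x ψ τ‖ₑ ^ 2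
  rw [← tsum_enorm_annihilate_sq ψ fun x σ => ENNReal.ofReal (g x) * cutoff M σ]
  have hschur := schur_le (m := fun x y => ‖offDiag h x y‖ₑ * ENNReal.ofReal (m x y))
    (fun x y => by rw [enorm_offDiag_symm hh, hm']) hL u
  -- Doubling matches the `2ab` in the elementary inequality with the factor `2` in the Schur test.
  refine (ENNReal.mul_le_mul_iff_right (a := 2) two_ne_zero (by norm_num)).1 ?_
  refine le_trans ?_ hschur
  rw [← ENNReal.tsum_mul_left]
  refine ENNReal.tsum_le_tsum fun p => ?_
  simp only [u]
  rw [← ENNReal.tsum_add, ← ENNReal.tsum_mul_left, ← ENNReal.tsum_mul_left]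
  refine ENNReal.tsum_le_tsum fun τ => ?_
  rw [cutSum_add_single_sub, cutoff_add_single M τ p.2 p.1, enorm_mul,
    Real.enorm_of_nonneg (NNReal.coe_nonneg _), ENNReal.ofReal_coe_nnreal]
  set χ : ℝ≥0∞ := (cutoff M (τ + Finsupp.single p.1 1) : ℝ≥0∞)
  set a := annihilate p.1 ψ τ
  set b := annihilate p.2 ψ τ
  have key : 2 * (‖f p.1 - f p.2‖ₑ * (‖a‖ₑ * ‖b‖ₑ)) ≤ ENNReal.ofReal (m p.1 p.2) *
      (ENNReal.ofReal (g p.1) * ‖a‖ₑ ^ 2 + ENNReal.ofReal (g p.2) * ‖b‖ₑ ^ 2) := by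
    have h1 := two_mul_abs_mul_le (hm p.1 p.2) (hg p.1) (hg p.2) (norm_nonneg a) (norm_nonneg b)
      (hfg p.1 p.2)
    have h2 := ENNReal.ofReal_le_ofReal h1
    rw [ENNReal.ofReal_mul (by norm_num), ENNReal.ofReal_mul (abs_nonneg _),
      ENNReal.ofReal_mul (norm_nonneg _), ENNReal.ofReal_mul (hm _ _),
      ENNReal.ofReal_add (mul_nonneg (hg _) (sq_nonneg _)) (mul_nonneg (hg _) (sq_nonneg _)),
      ENNReal.ofReal_mul (hg _), ENNReal.ofReal_mul (hg _), ENNReal.ofReal_pow (norm_nonneg _),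
      ENNReal.ofReal_pow (norm_nonneg _), ofReal_norm, ofReal_norm, ← Real.norm_eq_abs,
      ofReal_norm, ENNReal.ofReal_ofNat] at h2
    exact h2
  calc _ = χ * ‖offDiag h p.1 p.2‖ₑ * (2 * (‖f p.1 - f p.2‖ₑ * (‖a‖ₑ * ‖b‖ₑ))) := by ring
    _ ≤ χ * ‖offDiag h p.1 p.2‖ₑ * (ENNReal.ofReal (m p.1 p.2) *
      (ENNReal.ofReal (g p.1) * ‖a‖ₑ ^ 2 + ENNReal.ofReal (g p.2) * ‖b‖ₑ ^ 2)) := by gcongr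
    _ = _ := by ring

lemma IsPropagator.hamiltonian_apply {U : ℝ → (Fock Λ →L[ℂ] Fock Λ)} (hU : IsPropagator h v U)
    {ψ φ : Fock Λ} (hφ : hamiltonian h v ψ = φ) (t : ℝ) :
    hamiltonian h v (U t ψ) = U t φ := by
  rw [hU.generator]
  have h1 := ((U t).restrictScalars ℝ).hasFDerivAt.comp_hasDerivAt 0 ((hU.generator ψ φ).1 hφ)
  have h2 : ((U t).restrictScalars ℝ) (-(Complex.I • φ)) = -(Complex.I • U t φ) := by
    change U t _ = _
    rw [map_neg, map_smul]
  rw [h2] at h1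
  refine h1.congr_of_eventuallyEq (Eventually.of_forall fun s => ?_)
  change (U s * U t) ψ = (U t * U s) ψ
  rw [← hU.map_add, ← hU.map_add, add_comm]

lemma IsPropagator.hasDerivAt {U : ℝ → (Fock Λ →L[ℂ] Fock Λ)} (hU : IsPropagator h v U)
    {ψ φ : Fock Λ} (hφ : hamiltonian h v ψ = φ) (t : ℝ) :
    HasDerivAt (fun t => U t ψ) (-(Complex.I • U t φ)) t := by
  have h1 := (hU.generator _ _).1 (hU.hamiltonian_apply hφ t)
  have h2 : HasDerivAt (fun s => U s (U t ψ)) (-(Complex.I • U t φ)) (t - t) := by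
    rwa [sub_self]
  refine (h2.comp_sub_const t t).congr_of_eventuallyEq (Eventually.of_forall fun s => ?_)
  change U s ψ = (U (s - t) * U t) ψ
  rw [← hU.map_add, sub_add_cancel]

lemma diagForm_const_mul {I : Type*} (r : ℝ) (a : I → ℝ) (f : EllTwo I) :
    diagForm (fun i => r * a i) f = r * diagForm a f := by
  simp only [diagForm, mul_assoc, tsum_mul_left]

lemma cutSum_const_mul (M : ℕ) (r : ℝ) (f : Λ → ℝ) :
    cutSum M (fun x => r * f x) = fun σ => r * cutSum M f σ := by
  funext σ
  simp only [cutSum, siteSum, Finsupp.sum, mul_assoc, ← Finset.mul_sum]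
  ring

/-- The weight of a front that moves with the velocity `c`, at the time `t`. -/
def front (n : ℕ) (u : Λ → ℝ) (s r c t : ℝ) (x : Λ) : ℝ := profile n ((u x - r - c * t) / s)

lemma abs_front_le {n : ℕ} (hn : 1 ≤ n) (u : Λ → ℝ) (s r c t : ℝ) (x : Λ) :
    |front n u s r c t x| ≤ 2 := by
  rw [front, abs_of_nonneg (profile_nonneg _ _)]
  exact profile_le_two hn _

lemma abs_front_sub_le {n : ℕ} (hn : 1 ≤ n) (u : Λ → ℝ) {s : ℝ} (hs : 0 < s) (r c t w : ℝ) (x : Λ) :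
    |front n u s r c (t + w) x - front n u s r c t x -
      w * (-(c / s) * slope n ((u x - r - c * t) / s))| ≤ (n + 1) * (c / s) ^ 2 * w ^ 2 := by
  have h1 := abs_profile_sub_sub_le hn ((u x - r - c * t) / s) (-(c / s) * w)
  have h2 : (u x - r - c * (t + w)) / s = (u x - r - c * t) / s + -(c / s) * w := by
    field_simp
    ring
  rw [front, front, h2]
  calc _ = _ := by congr 1; ring
    _ ≤ _ := h1
    _ = _ := by ring

/-- The moving front loses `c / s` times the second quantization of the slope, and the current has
at most that size. The current is bounded in absolute value, so the sign `ε` lets the same argument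
run backward in time. -/
theorem antitone_diagForm_front (hh : ∀ x y, h x y = star (h y x))
    (hK : ∀ x, ∑' y, ‖offDiag h x y‖ₑ ≤ K) {U : ℝ → (Fock Λ →L[ℂ] Fock Λ)}
    (hU : IsPropagator h v U) {n : ℕ} (hn : 1 ≤ n) {u : Λ → ℝ} {s c : ℝ} (hs : 0 < s) (hc : 0 ≤ c)
    {m : Λ → Λ → ℝ} (hm : ∀ x y, 0 ≤ m x y) (hm' : ∀ x y, m x y = m y x)
    (hL : ∀ x, ∑' y, ‖offDiag h x y‖ₑ * ENNReal.ofReal (m x y) ≤ ENNReal.ofReal (c / s))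
    (r : ℝ)
    (hfront : ∀ t x y, (front n u s r c t x - front n u s r c t y) ^ 2 ≤
      m x y ^ 2 * (slope n ((u x - r - c * t) / s) * slope n ((u y - r - c * t) / s)))
    {ε : ℝ} (hε : |ε| = 1) (M : ℕ) {ψ φ : Fock Λ} (hφ : hamiltonian h v ψ = φ) :
    Antitone fun t => diagForm (cutSum M (front n u s r c t)) (U (ε * t) ψ) := by
  set q : ℝ := c / s with hq
  have hq0 : 0 ≤ q := by positivity
  let g : ℝ → Λ → ℝ := fun t x => slope n ((u x - r - c * t) / s)
  have hg0 : ∀ t x, 0 ≤ g t x := fun t x => (slope_pos _ _).le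
  have hg1 : ∀ t x, g t x ≤ 1 := fun t x => slope_le_one _ _
  let C : ℝ := (2 + q + (n + 1) * q ^ 2) * M
  have hder : ∀ t, HasDerivAt (fun t => diagForm (cutSum M (front n u s r c t)) (U (ε * t) ψ))
      (diagForm (cutSum M fun x => -q * g t x) (U (ε * t) ψ) +
        2 * ∑' σ, cutSum M (front n u s r c t) σ * (starRingEnd ℂ (U (ε * t) ψ σ) *
          (ε • -(Complex.I • U (ε * t) φ)) σ).re) t := by
    intro t
    have hy : HasDerivAt (fun t => U (ε * t) ψ) (ε • -(Complex.I • U (ε * t) φ)) t := by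
      have h1 := (hU.hasDerivAt hφ (ε * t)).scomp t ((hasDerivAt_id t).const_mul ε)
      rw [mul_one] at h1
      exact h1
    have hn0 : (0 : ℝ) ≤ (n + 1) * q ^ 2 := by positivity
    refine hasDerivAt_diagForm (C := C) (fun t σ => ?_) (fun σ => ?_) (fun w σ => ?_) hy
    · refine (abs_cutSum_le' (by norm_num) (abs_front_le hn u s r c t) M σ).trans ?_
      simp only [C]
      gcongr
      linarith
    · refine (abs_cutSum_le' hq0 (fun x => ?_) M σ).trans ?_
      · rw [abs_mul, abs_neg, abs_of_nonneg hq0, abs_of_nonneg (hg0 t x)]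
        exact mul_le_of_le_one_right hq0 (hg1 t x)
      · simp only [C]
        gcongr
        linarith
    · rw [cutSum_linear]
      refine (abs_cutSum_le' (by positivity) (abs_front_sub_le hn u hs r c t w) M σ).trans ?_
      rw [← hq]
      calc _ = (n + 1) * q ^ 2 * M * w ^ 2 := by ring
        _ ≤ _ := by
          simp only [C]
          gcongr
          linarith
  refine antitone_of_hasDerivAt_nonpos hder fun t => ?_
  have hpos : 0 ≤ diagForm (cutSum M (g t)) (U (ε * t) ψ) :=
    tsum_nonneg fun σ => mul_nonneg (cutSum_nonneg M (hg0 t) σ) (by positivity)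
  have hcur := current_cutSum_le hh hK (by norm_num) (abs_front_le hn u s r c t) (hg0 t) hm hm'
    (hfront t) hL M (hU.hamiltonian_apply hφ (ε * t))
  rw [← ofReal_diagForm_cutSum (hg0 t) (hg1 t), ← ENNReal.ofReal_mul hq0, ← ofReal_norm,
    Real.norm_eq_abs] at hcur
  have hcur' := (ENNReal.ofReal_le_ofReal_iff (by positivity)).1 hcur
  have hre : ∀ σ, (starRingEnd ℂ (U (ε * t) ψ σ) * (ε • -(Complex.I • U (ε * t) φ)) σ).re =
      ε * (starRingEnd ℂ (U (ε * t) ψ σ) * U (ε * t) φ σ).im := by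
    intro σ
    have h1 : (ε • -(Complex.I • U (ε * t) φ)) σ = ε * -(Complex.I * U (ε * t) φ σ) := rfl
    rw [h1]
    simp only [Complex.mul_re, Complex.mul_im, Complex.neg_re, Complex.neg_im, Complex.I_re,
      Complex.I_im, Complex.ofReal_re, Complex.ofReal_im, Complex.conj_re, Complex.conj_im]
    ring
  simp_rw [hre, mul_left_comm _ ε]
  rw [tsum_mul_left, cutSum_const_mul, diagForm_const_mul, mul_left_comm]
  set J := 2 * ∑' σ, cutSum M (front n u s r c t) σ *
    (starRingEnd ℂ (U (ε * t) ψ σ) * U (ε * t) φ σ).im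
  have : ε * J ≤ q * diagForm (cutSum M (g t)) (U (ε * t) ψ) := by
    refine (le_abs_self _).trans ?_
    rwa [abs_mul, hε, one_mul]
  change _ ≤ (0 : ℝ)
  linarith

/-- Finite combinations of basis vectors lie in the domain, since the columns are square summable;
they are the dense set on which the evolution is differentiated. -/
lemma exists_hamiltonian_sum_unitVec (hh : ∀ x y, h x y = star (h y x))
    (hK : ∀ x, ∑' y, ‖offDiag h x y‖ₑ ≤ K) (F : Finset (Config Λ)) (ψ : Fock Λ) :
    ∃ φ : Fock Λ, hamiltonian h v (∑ σ ∈ F, ψ σ • (unitVec σ : Fock Λ) : Fock Λ) = φ := by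
  have key : ∃ φ : Fock Λ, ∀ τ, inner ℂ (hamiltonianColumn h v τ)
      (∑ σ ∈ F, ψ σ • (unitVec σ : Fock Λ)) = φ τ := by
    refine Finset.sum_induction _
      (fun f : Fock Λ => ∃ φ : Fock Λ, ∀ τ, inner ℂ (hamiltonianColumn h v τ) f = φ τ)
      ?_ ⟨0, fun τ => inner_zero_right _⟩ fun σ _ => ?_
    · rintro f g ⟨φ, hφ⟩ ⟨χ, hχ⟩
      refine ⟨φ + χ, fun τ => ?_⟩
      rw [inner_add_right, hφ, hχ]
      rfl
    · refine ⟨ψ σ • hamiltonianColumn h v σ, fun τ => ?_⟩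
      rw [inner_smul_right, inner_unitVec_right, ← hamiltonianColumn_symm hh v hK]
      rfl
  obtain ⟨φ, hφ⟩ := key
  refine ⟨φ, funext fun τ => ?_⟩
  rw [← inner_hamiltonianColumn hh v hK, hφ]

/-- The cutoff makes both forms continuous on Fock space, so monotonicity passes from finite
combinations of basis vectors to every `ψ`. -/
theorem diagForm_front_le (hh : ∀ x y, h x y = star (h y x))
    (hK : ∀ x, ∑' y, ‖offDiag h x y‖ₑ ≤ K) {U : ℝ → (Fock Λ →L[ℂ] Fock Λ)}
    (hU : IsPropagator h v U) {n : ℕ} (hn : 1 ≤ n) {u : Λ → ℝ} {s c : ℝ} (hs : 0 < s) (hc : 0 ≤ c)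
    {m : Λ → Λ → ℝ} (hm : ∀ x y, 0 ≤ m x y) (hm' : ∀ x y, m x y = m y x)
    (hL : ∀ x, ∑' y, ‖offDiag h x y‖ₑ * ENNReal.ofReal (m x y) ≤ ENNReal.ofReal (c / s))
    (r : ℝ)
    (hfront : ∀ t x y, (front n u s r c t x - front n u s r c t y) ^ 2 ≤
      m x y ^ 2 * (slope n ((u x - r - c * t) / s) * slope n ((u y - r - c * t) / s)))
    (t : ℝ) (M : ℕ) (ψ : Fock Λ) :
    diagForm (cutSum M (front n u s r c |t|)) (U t ψ) ≤
      diagForm (cutSum M (front n u s r c 0)) ψ := by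
  obtain ⟨ε, hε, ht⟩ : ∃ ε : ℝ, |ε| = 1 ∧ ε * |t| = t := by
    rcases le_total 0 t with h0 | h0
    · exact ⟨1, abs_one, by rw [abs_of_nonneg h0, one_mul]⟩
    · exact ⟨-1, by rw [abs_neg, abs_one], by rw [abs_of_nonpos h0]; ring⟩
  have hbound := fun t σ => abs_cutSum_le' zero_le_two (abs_front_le hn u s r c t) M σ
  have hψ := tendsto_sum_unitVec ψ
  have h1 := ((continuous_diagForm _ (hbound |t|)).comp (U t).continuous).tendsto ψ |>.comp hψ
  have h2 := (continuous_diagForm _ (hbound 0)).tendsto ψ |>.comp hψ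
  refine le_of_tendsto_of_tendsto' h1 h2 fun F => ?_
  obtain ⟨φ, hφ⟩ := exists_hamiltonian_sum_unitVec (v := v) hh hK F ψ
  have h3 := antitone_diagForm_front hh hK hU hn hs hc hm hm' hL r hfront hε M hφ (abs_nonneg t)
  simp only [ht, mul_zero, hU.map_zero] at h3
  exact h3

end Velocity

/-! ### From pure states to positive operators. -/

section Expectation

lemma _root_.ContinuousLinearMap.IsPositive.exists_eq_mul_star {H : Type*} [NormedAddCommGroup H]
    [InnerProductSpace ℂ H] [CompleteSpace H] {A : H →L[ℂ] H} (hA : A.IsPositive) :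
    ∃ B : H →L[ℂ] H, A = B * star B := by
  have hA0 : 0 ≤ A := (ContinuousLinearMap.nonneg_iff_isPositive A).2 hA
  refine ⟨CFC.sqrt A, ?_⟩
  rw [(CFC.sqrt_nonneg A).isSelfAdjoint.star_eq, CFC.sqrt_mul_sqrt_self A hA0]

variable {d : ℕ} {Λ : Set (EuclideanSpace ℝ (Fin d))}

/-- The number of particles of a configuration in a region. -/
def occupation (S : Set Λ) (σ : Config Λ) : ℝ≥0∞ := ∑' x : S, ((σ x : ℕ) : ℝ≥0∞)

lemma occupation_eq_tsum_indicator (S : Set Λ) (σ : Config Λ) :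
    occupation S σ = ∑' x, S.indicator (1 : Λ → ℝ≥0∞) x * ((σ x : ℕ) : ℝ≥0∞) := by
  refine (tsum_subtype S fun x => ((σ x : ℕ) : ℝ≥0∞)).trans (tsum_congr fun x => ?_)
  by_cases hx : x ∈ S <;> simp [hx]

lemma occupation_univ (σ : Config Λ) : occupation univ σ = ∑' x, ((σ x : ℕ) : ℝ≥0∞) := by
  simp [occupation_eq_tsum_indicator]

lemma ofReal_re_number (S : Set Λ) (ψ : Config Λ → ℂ) (σ : Config Λ) :
    ENNReal.ofReal (number S ψ σ).re = occupation S σ * ENNReal.ofReal (ψ σ).re := by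
  have hs : Summable fun x : S => ((σ x : ℕ) : ℝ) := by
    have : Summable fun x : Λ => ((σ x : ℕ) : ℝ) :=
      summable_of_ne_finset_zero (s := σ.support) fun x hx => by
        simp [Finsupp.notMem_support_iff.1 hx]
    exact this.subtype S
  have h1 : number S ψ σ = ((∑' x : S, ((σ x : ℕ) : ℝ) : ℝ) : ℂ) * ψ σ := by
    simp only [number, create_annihilate_self]
    rw [tsum_mul_right, Complex.ofReal_tsum]
    simp
  have h2 : occupation S σ = ENNReal.ofReal (∑' x : S, ((σ x : ℕ) : ℝ)) := by
    rw [ENNReal.ofReal_tsum_of_nonneg (fun _ => Nat.cast_nonneg _) hs, occupation]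
    simp
  rw [h1, Complex.re_ofReal_mul, h2, ENNReal.ofReal_mul (tsum_nonneg fun _ => Nat.cast_nonneg _)]

/-- With `ρ = T T*` the trace becomes a sum of pure-state expectations over the vectors `T e_τ`; all
terms are nonnegative, so the sums commute even when infinite. -/
lemma expectation_number_mul_star (S : Set Λ) (T : Fock Λ →L[ℂ] Fock Λ) :
    expectation (number S) (T * star T) =
      ∑' τ, ∑' σ, occupation S σ * ‖T (unitVec τ) σ‖ₑ ^ 2 := by
  rw [ENNReal.tsum_comm, expectation]
  refine tsum_congr fun σ => ?_
  rw [ofReal_re_number, ENNReal.tsum_mul_left]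
  congr 1
  have h1 : ((T * star T) (basisVec σ) σ).re = ‖star T (unitVec σ)‖ ^ 2 := by
    change ((T (star T (unitVec σ))) σ).re = _
    rw [← inner_unitVec_left σ, ContinuousLinearMap.star_eq_adjoint,
      ← ContinuousLinearMap.adjoint_inner_left]
    exact inner_self_eq_norm_sq (𝕜 := ℂ) _
  rw [h1, ENNReal.ofReal_pow (norm_nonneg _), ofReal_norm, ← tsum_enorm_sq]
  refine tsum_congr fun τ => ?_
  rw [← inner_unitVec_left τ, ContinuousLinearMap.star_eq_adjoint,
    ContinuousLinearMap.adjoint_inner_right, inner_unitVec_right, ← ofReal_norm, ← ofReal_norm,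
    RCLike.norm_conj]

/-- A bound on pure states extends to all positive operators. -/
lemma expectation_evolve_le {S S' S'' : Set Λ} {C D : ℝ≥0∞} (V : Fock Λ →L[ℂ] Fock Λ)
    (hV : ∀ ψ : Fock Λ, ∑' σ, occupation S σ * ‖V ψ σ‖ₑ ^ 2 ≤
      C * (∑' σ, occupation S' σ * ‖ψ σ‖ₑ ^ 2 + D * ∑' σ, occupation S'' σ * ‖ψ σ‖ₑ ^ 2))
    {ρ : Fock Λ →L[ℂ] Fock Λ} (hρ : ρ.IsPositive) :
    expectation (number S) (V * ρ * star V) ≤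
      C * (expectation (number S') ρ + D * expectation (number S'') ρ) := by
  obtain ⟨B, hB⟩ := hρ.exists_eq_mul_star
  have h1 : V * ρ * star V = (V * B) * star (V * B) := by
    rw [hB, star_mul]
    simp only [mul_assoc]
  rw [h1, hB]
  simp only [expectation_number_mul_star]
  rw [← ENNReal.tsum_mul_left, ← ENNReal.tsum_add, ← ENNReal.tsum_mul_left]
  exact ENNReal.tsum_le_tsum fun τ => hV (B (unitVec τ))

end Expectation

/-! ### Comparison of the front with the two regions. -/

section Main

variable {d : ℕ} {Λ : Set (EuclideanSpace ℝ (Fin d))}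
variable {h : Λ → Λ → ℂ} {v : Λ → Λ → ℝ}

lemma front_le_of_eq_zero {n : ℕ} {η θ s : ℝ} (hη : 0 < η) (hθ : 0 < θ) (hs : 0 < s)
    (hn : 1 ≤ n) : profile n (-(η * θ / s)) ≤ (s / θ) ^ n * (η ^ n)⁻¹ := by
  have hn' : (1 : ℝ) ≤ n := by exact_mod_cast hn
  rw [profile_neg n (by positivity)]
  calc ((1 + η * θ / s) ^ n)⁻¹ / n ≤ ((1 + η * θ / s) ^ n)⁻¹ := div_le_self (by positivity) hn'
    _ ≤ ((η * θ / s) ^ n)⁻¹ := by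
        gcongr
        linarith
    _ = _ := by
        rw [← inv_pow, ← inv_pow, ← mul_pow]
        congr 1
        field_simp

/-- The velocity bound for pure states, for the regions cut out by a Lipschitz function. -/
theorem tsum_occupation_le {K : ℝ≥0} (hh : ∀ x y, h x y = star (h y x))
    (hK : ∀ x, ∑' y, ‖offDiag h x y‖ₑ ≤ K) {U : ℝ → (Fock Λ →L[ℂ] Fock Λ)}
    (hU : IsPropagator h v U) {n : ℕ} (hn : 1 ≤ n) {s c c' : ℝ} (hs : 0 < s) (hc' : 0 ≤ c')
    (hcc : c' < c) {m : Λ → Λ → ℝ} (hm : ∀ x y, 0 ≤ m x y) (hm' : ∀ x y, m x y = m y x)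
    (hL : ∀ x, ∑' y, ‖offDiag h x y‖ₑ * ENNReal.ofReal (m x y) ≤ ENNReal.ofReal (c' / s))
    {u : Λ → ℝ}
    (hprofile : ∀ r x y, (profile n ((u x - r) / s) - profile n ((u y - r) / s)) ^ 2 ≤
      m x y ^ 2 * (slope n ((u x - r) / s) * slope n ((u y - r) / s)))
    {η t : ℝ} (hη : 1 ≤ η) (ht : |t| < η / c) {X Y : Set Λ} (hX : ∀ x ∈ X, u x = 0)
    (hY : ∀ x ∈ Y, η ≤ u x) (ψ : Fock Λ) :
    ∑' σ, occupation Y σ * ‖U t ψ σ‖ₑ ^ 2 ≤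
      ENNReal.ofReal (n * (2 + (s / (1 - c' / c)) ^ n)) *
        (∑' σ, occupation Xᶜ σ * ‖ψ σ‖ₑ ^ 2 +
          ENNReal.ofReal ((η ^ n)⁻¹) * ∑' σ, occupation univ σ * ‖ψ σ‖ₑ ^ 2) := by
  have hc : 0 < c := by linarith
  have hη0 : 0 < η := by linarith
  have hn0 : (0 : ℝ) < n := by exact_mod_cast hn
  set θ := 1 - c' / c with hθ
  have hθ0 : 0 < θ := by
    rw [hθ, sub_pos, div_lt_one hc]
    exact hcc
  -- The front starts at distance `r` from `X` and, since `r + c' η / c = η`, has not passed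
  -- distance `η` by time `|t| < η / c`.
  set r := η * θ with hr
  set D := (s / θ) ^ n with hD
  have hD0 : 0 < D := by positivity
  have hmain := diagForm_front_le hh hK hU hn hs hc' hm hm' hL r
    (fun t x y => by
      simp only [front, sub_sub]
      exact hprofile _ x y) t
  have hf0 : ∀ t x, 0 ≤ front n u s r c' t x := fun t x => profile_nonneg _ _
  have hf2 : ∀ t x, front n u s r c' t x ≤ 2 := fun t x => profile_le_two hn _
  have hY' : ∀ x ∈ Y, 1 / (n : ℝ) ≤ front n u s r c' |t| x := by
    intro x hx
    rw [← profile_zero, front]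
    refine monotone_profile hn (div_nonneg ?_ hs.le)
    have h1 : c' * |t| ≤ c' * (η / c) := by gcongr
    have h2 : η - r - c' * (η / c) = 0 := by
      rw [hr, hθ]
      field_simp
      ring
    linarith [hY x hx]
  have hX' : ∀ x, ENNReal.ofReal (front n u s r c' 0 x) ≤
      2 * Xᶜ.indicator (1 : Λ → ℝ≥0∞) x + ENNReal.ofReal (D * (η ^ n)⁻¹) := by
    intro x
    by_cases hx : x ∈ X
    · refine le_add_left (ENNReal.ofReal_le_ofReal ?_)
      rw [front, hX x hx]
      have : (0 - r - c' * 0) / s = -(η * θ / s) := by rw [hr]; ring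
      rw [this]
      exact front_le_of_eq_zero hη0 hθ0 hs hn
    · rw [indicator_of_mem (show x ∈ Xᶜ from hx), Pi.one_apply, mul_one]
      refine le_add_right ?_
      rw [← ENNReal.ofReal_ofNat]
      exact ENNReal.ofReal_le_ofReal (hf2 0 x)
  have hinit : ∀ M : ℕ, ENNReal.ofReal (diagForm (cutSum M (front n u s r c' 0)) ψ) ≤
      2 * ∑' σ, occupation Xᶜ σ * ‖ψ σ‖ₑ ^ 2 +
        ENNReal.ofReal (D * (η ^ n)⁻¹) * ∑' σ, occupation univ σ * ‖ψ σ‖ₑ ^ 2 := by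
    intro M
    rw [ofReal_diagForm_cutSum (hf0 0) (hf2 0), ← ENNReal.tsum_mul_left, ← ENNReal.tsum_mul_left,
      ← ENNReal.tsum_add]
    refine ENNReal.tsum_le_tsum fun σ => ?_
    rw [← mul_assoc, ← mul_assoc, ← add_mul, occupation_eq_tsum_indicator, occupation_univ,
      ← ENNReal.tsum_mul_left, ← ENNReal.tsum_mul_left, ← ENNReal.tsum_add]
    gcongr with x
    calc ENNReal.ofReal (front n u s r c' 0 x) * cutoff M σ * (σ x : ℕ)
        ≤ ENNReal.ofReal (front n u s r c' 0 x) * 1 * (σ x : ℕ) := by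
          gcongr
          exact_mod_cast cutoff_le_one M σ
      _ ≤ (2 * Xᶜ.indicator 1 x + ENNReal.ofReal (D * (η ^ n)⁻¹)) * (σ x : ℕ) := by
          rw [mul_one]
          gcongr
          exact hX' x
      _ = _ := by ring
  have hfinal : ∀ F : Finset (Config Λ), ∑ σ ∈ F, occupation Y σ * ‖U t ψ σ‖ₑ ^ 2 ≤
      n * (2 * ∑' σ, occupation Xᶜ σ * ‖ψ σ‖ₑ ^ 2 +
        ENNReal.ofReal (D * (η ^ n)⁻¹) * ∑' σ, occupation univ σ * ‖ψ σ‖ₑ ^ 2) := by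
    intro F
    -- The cutoff is chosen to be inactive on the finite set `F`. The initial bound does not depend
    -- on it, so the supremum over `F` removes the cutoff.
    set M := F.sup fun σ : Config Λ => σ.degree
    calc ∑ σ ∈ F, occupation Y σ * ‖U t ψ σ‖ₑ ^ 2
        ≤ ∑ σ ∈ F, n * ((∑' x, (ENNReal.ofReal (front n u s r c' |t| x) * cutoff M σ) *
          (σ x : ℕ)) * ‖U t ψ σ‖ₑ ^ 2) := by
          refine Finset.sum_le_sum fun σ hσ => ?_
          rw [← mul_assoc]
          gcongr
          have hM : cutoff M σ = 1 := if_pos (Finset.le_sup (f := fun σ : Config Λ => σ.degree) hσ)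
          rw [occupation_eq_tsum_indicator, ← ENNReal.tsum_mul_left, hM]
          refine ENNReal.tsum_le_tsum fun x => ?_
          rw [ENNReal.coe_one, mul_one, ← mul_assoc]
          gcongr
          by_cases hx : x ∈ Y
          · rw [indicator_of_mem hx, Pi.one_apply, ← ENNReal.ofReal_natCast,
              ← ENNReal.ofReal_mul hn0.le, ← ENNReal.ofReal_one]
            refine ENNReal.ofReal_le_ofReal ?_
            have := hY' x hx
            rwa [div_le_iff₀' hn0] at this
          · rw [indicator_of_notMem hx]
            exact zero_le
      _ ≤ n * ENNReal.ofReal (diagForm (cutSum M (front n u s r c' |t|)) (U t ψ)) := by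
          rw [← Finset.mul_sum, ofReal_diagForm_cutSum (hf0 |t|) (hf2 |t|)]
          gcongr
          exact ENNReal.sum_le_tsum F
      _ ≤ n * ENNReal.ofReal (diagForm (cutSum M (front n u s r c' 0)) ψ) := by
          gcongr
          exact hmain M ψ
      _ ≤ _ := by
          gcongr
          exact hinit M
  rw [ENNReal.tsum_eq_iSup_sum]
  refine iSup_le fun F => (hfinal F).trans ?_
  rw [ENNReal.ofReal_mul hn0.le, ENNReal.ofReal_natCast, ENNReal.ofReal_mul hD0.le,
    ENNReal.ofReal_add (by norm_num) hD0.le, ENNReal.ofReal_ofNat, mul_assoc (n : ℝ≥0∞),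
    mul_add (2 + _), mul_assoc (ENNReal.ofReal D)]
  gcongr
  · exact le_self_add
  · exact le_add_self

end Main

end LatticeBosons

end

/-! ### Choice of the constants and of the distance function. -/

open LatticeBosons

theorem theorem2p1 (n : ℕ) (hn : 1 ≤ n) (κn κ : ℝ≥0) (c : ℝ) (hc : (κ : ℝ) < c) :
    ∃ C : ℝ, 0 < C ∧
      ∀ (d : ℕ) (Λ : Set (EuclideanSpace ℝ (Fin d)))
        (_hΛ : Λ.Pairwise fun x y => 1 ≤ dist x y)
        (h : Λ → Λ → ℂ) (_hh : ∀ x y, h x y = star (h y x))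
        (v : Λ → Λ → ℝ) (_hv : ∀ x y, v x y = v y x)
        (_hκn : LatticeBosons.hopMoment h n = κn)
        (_hκ : LatticeBosons.hopMoment h 0 = κ),
        (∃ U, LatticeBosons.IsPropagator h v U) ∧
        ∀ U, LatticeBosons.IsPropagator h v U →
          ∀ (η : ℝ) (_hη : 1 ≤ η) (X : Set Λ) (t : ℝ) (_ht : |t| < η / c)
            (ρ : LatticeBosons.Fock Λ →L[ℂ] LatticeBosons.Fock Λ)
            (_hρ : LatticeBosons.IsDensity ρ),
            LatticeBosons.expectation (LatticeBosons.number (Metric.cthickening η X)ᶜ)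
                (LatticeBosons.evolve U t ρ) ≤
              ENNReal.ofReal C *
                (LatticeBosons.expectation (LatticeBosons.number Xᶜ) ρ +
                  ENNReal.ofReal ((η ^ n)⁻¹) *
                    LatticeBosons.expectation (LatticeBosons.number Set.univ) ρ) := by
  have hκ0 : (0 : ℝ) ≤ κ := κ.coe_nonneg
  -- The speed of the front lies strictly between `κ` and `c`: the gap above `κ` absorbs the errors
  -- of the profile, and the gap below `c` leaves the initial margin that produces `η⁻ⁿ`.
  set c' : ℝ := (κ + c) / 2 with hc'
  have hκc' : (κ : ℝ) < c' := by rw [hc']; linarith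
  have hc'c : c' < c := by rw [hc']; linarith
  have hc'0 : 0 ≤ c' := hκ0.trans hκc'.le
  obtain ⟨s, a, b, hs, ha, hb, hab, hscale⟩ := exists_profile_scale hn κn.coe_nonneg hκc'
  have hθ : 0 < 1 - c' / c := by
    rw [sub_pos, div_lt_one (by linarith)]
    exact hc'c
  refine ⟨n * (2 + (s / (1 - c' / c)) ^ n), by positivity, ?_⟩
  intro d Λ hΛ h hh v _ hκn hκ
  have hK : ∀ x, ∑' y, ‖offDiag h x y‖ₑ ≤ κ := fun x => hκ ▸ tsum_enorm_offDiag_le hΛ x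
  refine ⟨exists_isPropagator hh hK, fun U hU η hη X t ht ρ hρ => ?_⟩
  refine expectation_evolve_le (U t) (fun ψ => ?_) hρ.1
  obtain ⟨u, hu, hX, hY⟩ : ∃ u : Λ → ℝ, (∀ x y, |u x - u y| ≤ dist x y) ∧
      (∀ x ∈ X, u x = 0) ∧ ∀ x ∈ (Metric.cthickening η X)ᶜ, η ≤ u x := by
    rcases X.eq_empty_or_nonempty with rfl | hne
    -- For empty `X` the thickening is empty as well, and the real-valued `Metric.infDist` would be
    -- `0`; the constant `η` has the required properties instead.
    · exact ⟨fun _ => η, fun x y => by simp, fun x hx => hx.elim, fun x _ => le_rfl⟩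
    · refine ⟨fun x => Metric.infDist x X, fun x y => ?_, fun x hx => ?_, fun x hx => ?_⟩
      · have := (Metric.lipschitz_infDist_pt X).dist_le_mul x y
        rwa [NNReal.coe_one, one_mul, Real.dist_eq] at this
      · exact Metric.infDist_zero_of_mem hx
      · by_contra hlt
        refine hx ?_
        rw [Metric.mem_cthickening_iff, ← ENNReal.ofReal_toReal (Metric.infEDist_ne_top hne)]
        exact ENNReal.ofReal_le_ofReal (not_le.1 hlt).le
  -- Weighted by the hopping, this kernel has row sums at most `(a κ + b κn) / s ≤ c' / s`.
  let m : Λ → Λ → ℝ := fun x y => (a * dist x y + b * dist x y ^ (n + 1)) / s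
  have hm : ∀ x y, 0 ≤ m x y := fun x y => by positivity
  refine tsum_occupation_le hh hK hU hn hs hc'0 hc'c hm (fun x y => by simp only [m, dist_comm])
    (fun x => ?_) (u := u) (fun r x y => ?_) hη ht hX hY ψ
  · have hterm : ∀ y, ‖offDiag h x y‖ₑ * ENNReal.ofReal (m x y) ≤
        ENNReal.ofReal s⁻¹ * (ENNReal.ofReal a * ENNReal.ofReal (‖h x y‖ * dist x y ^ (0 + 1)) +
          ENNReal.ofReal b * ENNReal.ofReal (‖h x y‖ * dist x y ^ (n + 1))) := by
      intro y
      rw [← ENNReal.ofReal_mul ha, ← ENNReal.ofReal_mul hb,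
        ← ENNReal.ofReal_add (by positivity) (by positivity),
        ← ENNReal.ofReal_mul (by positivity)]
      calc _ ≤ ‖h x y‖ₑ * ENNReal.ofReal (m x y) := by
            gcongr
            exact enorm_offDiag_le h x y
        _ = ENNReal.ofReal (‖h x y‖ * m x y) := by
            rw [ENNReal.ofReal_mul (norm_nonneg _), ofReal_norm]
        _ = _ := by
            congr 1
            simp only [m]
            rw [div_eq_inv_mul]
            ring
    refine (ENNReal.tsum_le_tsum hterm).trans ?_
    rw [ENNReal.tsum_mul_left, ENNReal.tsum_add, ENNReal.tsum_mul_left, ENNReal.tsum_mul_left]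
    have h0 : ∑' y, ENNReal.ofReal (‖h x y‖ * dist x y ^ (0 + 1)) ≤ ENNReal.ofReal κ := by
      rw [ENNReal.ofReal_coe_nnreal, ← hκ]
      exact le_iSup (fun x : Λ => ∑' y : Λ, ENNReal.ofReal (‖h x y‖ * dist x y ^ (0 + 1))) x
    have h1 : ∑' y, ENNReal.ofReal (‖h x y‖ * dist x y ^ (n + 1)) ≤ ENNReal.ofReal κn := by
      rw [ENNReal.ofReal_coe_nnreal, ← hκn]
      exact le_iSup (fun x : Λ => ∑' y : Λ, ENNReal.ofReal (‖h x y‖ * dist x y ^ (n + 1))) x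
    calc _ ≤ ENNReal.ofReal s⁻¹ * (ENNReal.ofReal a * ENNReal.ofReal κ +
          ENNReal.ofReal b * ENNReal.ofReal κn) := by gcongr
      _ = ENNReal.ofReal (s⁻¹ * (a * κ + b * κn)) := by
          rw [ENNReal.ofReal_mul (by positivity), ENNReal.ofReal_add (by positivity)
            (by positivity), ENNReal.ofReal_mul ha, ENNReal.ofReal_mul hb]
      _ ≤ _ := by
          refine ENNReal.ofReal_le_ofReal ?_
          rw [div_eq_inv_mul]
          gcongr
  · refine (hscale (u x - r) (u y - r)).trans ?_
    have h1 : |u x - r - (u y - r)| ≤ dist x y := by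
      rw [sub_sub_sub_cancel_right]
      exact hu x y
    have h2 := (slope_pos n ((u x - r) / s)).le
    have h3 := (slope_pos n ((u y - r) / s)).le
    simp only [m]
    gcongr
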